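/- Let $K$ be a field, let $\beta\in K$, and set $x\oplus y=x+y+\beta xy$, $x\ominus y=\frac{x-y}{1+\beta y}$ and $\ominus y=0\ominus y$. Let $n,k\ge 0$, $N=n+k$, and let $t=(t_j)_{j\in\mathbb{Z}}$ be parameters in $K$ with $1+\beta t_j\neq 0$ for $1\le j\le N$ (for instance, $\beta$, $t_1,\dots,t_N$ and the $x_i$ below may be indeterminates and $K$ a field of rational functions in them). Write $\ominus t=(\ominus t_j)_j$ and $\ominus t'=(\ominus t_{N+1-j})_j$. For a partition $\lambda=(\lambda_1\ge\dots\ge\lambda_n\ge 0)$ with $\lambda_1\le k$, written $\lambda\subset(k^n)$, let $I_\lambda=\{\lambda_{n+1-i}+i : 1\le i\le n\}\subset\{1,\dots,N\}$ and $I_{\lambda^*}=\{1,\dots,N\}\setminus I_\lambda$. Let $\lambda^\vee$ be the complementary partition, $\lambda^\vee_i=k-\lambda_{n+1-i}$, let $t_\lambda=(t_{\lambda_n+1},\dots,t_{\lambda_{n+1-i}+i},\dots,t_{\lambda_1+n})$, and for $y=(y_1,\dots,y_n)$ let $\Pi(y)=\prod_{i=1}^n(1+\beta y_i)$. The factorial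 Grothendieck polynomial is $$G_\lambda(x_1,\dots,x_n|t)=\sum_T\beta^{|T|-|\lambda|}\prod_{(i,j)\in\lambda,\ r\in T(i,j)}x_r\oplus t_{r+j-i},$$ where $T$ runs over the set-valued tableaux of shape $\lambda$, i.e. the maps assigning to each box a non-empty subset of $\{1,\dots,n\}$ such that $\max T(i,j)\le\min T(i,j+1)$ and $\max T(i,j)<\min T(i+1,j)$, and $|T|=\sum_{(i,j)\in\lambda}|T(i,j)|$. Let $V$ have basis $v_0,v_1$, let $\sigma^-v_1=v_0$, $\sigma^-v_0=0$, $\sigma^+v_0=v_1$, $\sigma^+v_1=0$, and let $$L(x|t_j)=\begin{pmatrix}\sigma^+\sigma^-+(x\ominus t_j)\,\sigma^-\sigma^+ & (1+\beta\,(x\ominus t_j))\,\sigma^+\\ \sigma^- & \sigma^-\sigma^+\end{pmatrix}.$$ Let $L_j(x)$ be $L(x|t_j)$ with its entries acting on the $j$th factor of $V^{\otimes N}$, and define operators $A(x),B(x),C(x),D(x)$ on $V^{\otimes N}$ by $\begin{pmatrix}A(x)&B(x)\\C(x)&D(x)\end{pmatrix}=L_N(x)\cdots L_2(x)L_1(x)$.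 Let $e(x,y)=\langle 0|C(x_1)\cdots C(x_n)B(y_n)\cdots B(y_1)|0\rangle$ be the diagonal matrix element at $|0\rangle=v_0\otimes\cdots\otimes v_0$ with respect to the basis of tensor products of $v_0$ and $v_1$. Then for every $\mu\subset(k^n)$ and all $x=(x_1,\dots,x_n)\in K^n$, $$\prod_{i=1}^n\prod_{j\in I_{\mu^*}}(x_i\ominus t_j)=\sum_{\lambda\subset(k^n)}\frac{\Pi(t_\mu)}{\Pi(t_\lambda)}\,G_{\lambda^\vee}(t_\mu|\ominus t')\,G_\lambda(x|\ominus t),$$ and moreover $$e(t_\mu,t_\mu)=\prod_{i\in I_\mu}\prod_{j\in I_{\mu^*}}(t_i\ominus t_j).$$ -/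

import Mathlib

namespace FactorialGrothendieck

open Finset

section GroupLaw

variable {K : Type*} [Field K]

/-- The multiplicative formal group law `x ⊕ y = x + y + β x y`. -/
def oplus (β x y : K) : K := x + y + β * x * y

/-- Its difference `x ⊖ y = (x - y) / (1 + β y)`. -/
def ominus (β x y : K) : K := (x - y) / (1 + β * y)

/-- The parameters `⊖ t`, that is `j ↦ 0 ⊖ t_j`. -/
def negParams (β : K) (t : ℤ → K) : ℤ → K := fun j => ominus β 0 (t j)

/-- The reversed parameters `t' = (t_N, …, t_1)`, that is `t'_j = t_{N+1-j}`. -/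
def revParams (N : ℕ) (t : ℤ → K) : ℤ → K := fun j => t (N + 1 - j)

/-- `Π(x) = ∏_i (1 + β x_i)`. -/
def bigPi (β : K) {n : ℕ} (x : Fin n → K) : K := ∏ i, (1 + β * x i)

end GroupLaw

section Partitions

/-- Partitions `k ≥ λ_1 ≥ ⋯ ≥ λ_n ≥ 0`, i.e. `λ ⊂ (k^n)`; the part `λ_{i+1}` is `lam.1 i`. -/
abbrev BoxedPartition (n k : ℕ) : Type :=
  {lam : Fin n → Fin (k + 1) // ∀ i j, i ≤ j → lam j ≤ lam i}

variable {n k : ℕ}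

/-- The complement `λ^∨` of `λ` in the bounding box: `λ^∨_i = k - λ_{n+1-i}`. -/
def vee (lam : BoxedPartition n k) : BoxedPartition n k :=
  ⟨fun i => (lam.1 i.rev).rev,
    fun _ _ h => Fin.rev_le_rev.mpr (lam.2 _ _ (Fin.rev_le_rev.mpr h))⟩

/-- The position of the `i`-th 1-letter (from the left) of the binary string of `λ`:
`w(i) = λ_{n+1-i} + i` for `i = 1, …, n` (here `i` is shifted by one). -/
def letterPos (lam : BoxedPartition n k) (i : Fin n) : ℤ := ((lam.1 i.rev : ℕ) : ℤ) + (i : ℕ) + 1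

/-- `I_λ = {w(1), …, w(n)}`, the set of positions of the 1-letters of the binary string of `λ`. -/
def oneLetters (lam : BoxedPartition n k) : Finset ℤ := univ.image (letterPos lam)

/-- `I_{λ^*}`: as `λ^*` has the binary string of `λ` with 0- and 1-letters swapped, this is the
complement of `I_λ` in `{1, …, n + k}`. -/
noncomputable def oneLettersStar (lam : BoxedPartition n k) : Finset ℤ :=
  Icc (1 : ℤ) ((n + k : ℕ) : ℤ) \ oneLetters lam

/-- `t_λ = (t_{λ_n + 1}, …, t_{λ_1 + n})`. -/
def tParams {K : Type*} (t : ℤ → K) (lam : BoxedPartition n k) : Fin n → K :=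
  fun i => t (letterPos lam i)

/-- The Young diagram of `λ`; the box in row `i` and column `j` (counted from 1) is
`(i - 1, j - 1)`. -/
def diagram (lam : BoxedPartition n k) : Finset (ℕ × ℕ) :=
  (univ : Finset (Fin n)).biUnion fun i =>
    (range (lam.1 i : ℕ)).image fun j => ((i : ℕ), j)

end Partitions

section Grothendieck

/-- Set-valued tableaux of shape `θ` with entries in `{1, …, n}` (the entry `r` is `r - 1 : Fin n`):
the boxes are filled with nonempty sets such that `max T(i,j) ≤ min T(i,j+1)` and
`max T(i,j) < min T(i+1,j)`. -/
def IsSetValuedTableau {n : ℕ} (θ : Finset (ℕ × ℕ)) (T : θ → Finset (Fin n)) : Prop :=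
  (∀ c, (T c).Nonempty) ∧
  (∀ c d : θ, d.1 = (c.1.1, c.1.2 + 1) → ∀ a ∈ T c, ∀ b ∈ T d, a ≤ b) ∧
  (∀ c d : θ, d.1 = (c.1.1 + 1, c.1.2) → ∀ a ∈ T c, ∀ b ∈ T d, a < b)

instance {n : ℕ} (θ : Finset (ℕ × ℕ)) :
    DecidablePred (IsSetValuedTableau (n := n) θ) := fun T => by
  unfold IsSetValuedTableau; infer_instance

/-- The finite set of set-valued tableaux of shape `θ`. -/
def SVT (n : ℕ) (θ : Finset (ℕ × ℕ)) : Finset (θ → Finset (Fin n)) :=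
  univ.filter (IsSetValuedTableau θ)

/-- The factorial Grothendieck polynomial
`G_θ(x|t) = ∑_T β^{|T| - |θ|} ∏_{(i,j) ∈ θ, r ∈ T(i,j)} x_r ⊕ t_{r+j-i}`.
(Row, column and entry are each counted from 0 here, so `r + j - i` becomes `r + j - i + 1`.) -/
def groth {K : Type*} [Field K] (β : K) {n : ℕ} (θ : Finset (ℕ × ℕ)) (x : Fin n → K)
    (t : ℤ → K) : K :=
  ∑ T ∈ SVT n θ, β ^ ((∑ c, #(T c)) - #θ) *
    ∏ c, ∏ r ∈ T c, oplus β (x r) (t (((r : ℕ) : ℤ) + (c.1.2 : ℤ) - (c.1.1 : ℤ) + 1))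

end Grothendieck

section YangBaxter

variable {K : Type*} [Field K]

/-- `σ⁻ v_1 = v_0`, `σ⁻ v_0 = 0`. -/
def sigmaMinus : Matrix (Fin 2) (Fin 2) K := !![0, 1; 0, 0]

/-- `σ⁺ v_0 = v_1`, `σ⁺ v_1 = 0`. -/
def sigmaPlus : Matrix (Fin 2) (Fin 2) K := !![0, 0; 1, 0]

/-- The `L`-operator `L(x|t)`, a 2×2 matrix (auxiliary space) of operators on `V`. -/
def lOperator (β x t : K) : Matrix (Fin 2) (Fin 2) (Matrix (Fin 2) (Fin 2) K) :=
  !![sigmaPlus * sigmaMinus + ominus β x t • (sigmaMinus * sigmaPlus),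
      (1 + β * ominus β x t) • sigmaPlus;
    sigmaMinus, sigmaMinus * sigmaPlus]

/-- Operators on the quantum space `V^{⊗N}`, as matrices in the spin basis
`v_b = v_{b_1} ⊗ ⋯ ⊗ v_{b_N}`, which is indexed by the binary strings `b` of length `N`. -/
abbrev QuantumOp (N : ℕ) (K : Type*) : Type _ := Matrix (Fin N → Fin 2) (Fin N → Fin 2) K

/-- The operator on `V^{⊗N}` acting as `a` on the factor `j` and as the identity elsewhere. -/
def atSite {N : ℕ} (j : Fin N) (a : Matrix (Fin 2) (Fin 2) K) : QuantumOp N K :=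
  fun b b' => if ∀ l, l ≠ j → b l = b' l then a (b j) (b' j) else 0

/-- The row monodromy matrix `M(x|t) = L_N ⋯ L_2 L_1` with `L_j = L(x|t_j)` acting on the
auxiliary space and on the factor `j` of the quantum space. -/
def monodromy (β : K) (N : ℕ) (t : ℤ → K) (x : K) : Matrix (Fin 2) (Fin 2) (QuantumOp N K) :=
  (List.ofFn fun j : Fin N =>
    (lOperator β x (t (((j : ℕ) : ℤ) + 1))).map (atSite j)).reverse.prod

/-- The entry `B(x|t)` of the monodromy matrix with rows `(A, B)`, `(C, D)`. -/
def opB (β : K) (N : ℕ) (t : ℤ → K) (x : K) : QuantumOp N K := monodromy β N t x 0 1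

/-- The entry `C(x|t)` of the monodromy matrix with rows `(A, B)`, `(C, D)`. -/
def opC (β : K) (N : ℕ) (t : ℤ → K) (x : K) : QuantumOp N K := monodromy β N t x 1 0

/-- The matrix element
`e(x, y) = ⟨0| C(x_1) ⋯ C(x_n) B(y_n) ⋯ B(y_1) |0⟩`, where `|0⟩ = v_0 ⊗ ⋯ ⊗ v_0`. -/
def eForm (β : K) (N : ℕ) (t : ℤ → K) {n : ℕ} (x y : Fin n → K) : K :=
  ((List.ofFn fun i => opC β N t (x i)).prod *
    (List.ofFn fun i => opB β N t (y i)).reverse.prod) (fun _ => 0) (fun _ => 0)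

end YangBaxter

end FactorialGrothendieck

open FactorialGrothendieck

/-! Both claims follow from evaluating e(x, t_μ) in two ways. Read an index 1 as a particle and 0 as
its absence, and let the auxiliary line run through the sites in increasing order.

In the first evaluation, the spin basis is inserted between the C's and the B's. In C(x) the
auxiliary line enters empty and leaves occupied: it carries off the top particle, while each other
particle may hop upwards, but not as far as the old position of the next one. On partitions this
removes a horizontal strip and one part, and its weights are those of deleting the largest entry
from a set-valued tableau (`rowMatrix_spins_one_zero`, `groth_shape_succ`). Hence ⟨0|C⋯C|λ⟩ is
G_λ(x|⊖t) (`prod_opC_state`). Reading a row backwards turns B into C up to factors 1 + β·, which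
produce Π(y)/Π(t_λ), and replaces t by t' and λ by λ^∨. The result is `eForm_eq_sum_groth`.

In the second evaluation, e is symmetric in t_1, …, t_N: a matrix acting on two neighbouring sites
intertwines the rows with exchanged parameters and fixes the vacuum from both sides (`eForm_swap`,
`eForm_perm`). So the entries of t_μ may be moved to the last n sites. There vanishing weights force
B⋯B|0⟩ to be the single state of (k^n), and G_{(k^n)} is a product (`eForm_packed`,
`eForm_tParams`).

Equating the two gives the first identity; the second is the product formula at x = t_μ. -/

namespace FactorialGrothendieck

open Finset

/-! ### Matrix elements of the monodromy as products of 2×2 matrices -/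

section RowMatrix

variable {K : Type*} [Field K]

/-- The entry of the `L`-operator with outgoing spin `c` and incoming spin `d`, as a matrix on the
auxiliary space, in terms of `u = x ⊖ t`. -/
def vertex (β u : K) (c d : Fin 2) : Matrix (Fin 2) (Fin 2) K :=
  ![![!![u, 0; 0, 1], !![0, 0; 1, 0]], ![!![0, 1 + β * u; 0, 0], !![1, 0; 0, 0]]] c d

lemma lOperator_apply (β x t : K) (a a' c d : Fin 2) :
    lOperator β x t a a' c d = vertex β (ominus β x t) c d a a' := by
  fin_cases a <;> fin_cases a' <;> fin_cases c <;> fin_cases d <;>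
    simp [lOperator, vertex, sigmaPlus, sigmaMinus]

/-- The matrix element of the monodromy matrix of the first `m` sites, with outgoing spins `b'` and
incoming spins `b`, as a matrix on the auxiliary space. -/
def rowMatrix (β : K) (u : ℕ → K) (b' b : ℕ → Fin 2) : ℕ → Matrix (Fin 2) (Fin 2) K
  | 0 => 1
  | m + 1 => vertex β (u m) (b' m) (b m) * rowMatrix β u b' b m

lemma rowMatrix_congr {β : K} {u v : ℕ → K} {b' c' b c : ℕ → Fin 2} {m : ℕ}
    (hu : ∀ s < m, u s = v s) (hb' : ∀ s < m, b' s = c' s) (hb : ∀ s < m, b s = c s) :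
    rowMatrix β u b' b m = rowMatrix β v c' c m := by
  induction m with
  | zero => rfl
  | succ m ih =>
    rw [rowMatrix, rowMatrix, ih (fun s h => hu s (by omega)) (fun s h => hb' s (by omega))
      (fun s h => hb s (by omega)), hu m (by omega), hb' m (by omega), hb m (by omega)]

/-- The extension of a string of spins by zeros. -/
def extendSpins {N : ℕ} (b : Fin N → Fin 2) : ℕ → Fin 2 :=
  fun s => if h : s < N then b ⟨s, h⟩ else 0

lemma extendSpins_apply {N : ℕ} (b : Fin N → Fin 2) (j : Fin N) : extendSpins b j = b j := by
  simp [extendSpins]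

lemma extendSpins_of_lt {N : ℕ} (b : Fin N → Fin 2) {s : ℕ} (h : s < N) :
    extendSpins b s = b ⟨s, h⟩ := by
  simp [extendSpins, h]

/-- Keeping the full quantum space while using only the first m sites allows induction on m; the
untouched sites account for the diagonal condition. -/
lemma partial_monodromy_apply (β x : K) {N : ℕ} (t : ℤ → K) (m : ℕ) (hm : m ≤ N) (a c : Fin 2)
    (b' b : Fin N → Fin 2) :
    (List.ofFn fun j : Fin m =>
      (lOperator β x (t (((j : ℕ) : ℤ) + 1))).map (atSite (Fin.castLE hm j))).reverse.prod a c b' b =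
    if ∀ l : Fin N, m ≤ l → b' l = b l then
      rowMatrix β (fun s => ominus β x (t (s + 1))) (extendSpins b') (extendSpins b) m a c
    else 0 := by
  induction m generalizing a b' with
  | zero =>
    have h : (∀ l : Fin N, 0 ≤ (l : ℕ) → b' l = b l) ↔ b' = b :=
      ⟨fun h => funext fun l => h l (Nat.zero_le _), fun h l _ => congrFun h l⟩
    simp only [List.ofFn_zero, List.reverse_nil, List.prod_nil, h, rowMatrix, Matrix.one_apply]
    by_cases h1 : a = c <;> simp [h1, Matrix.one_apply]
  | succ m ih =>
    have hmN : m < N := hm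
    rw [List.ofFn_succ', List.concat_eq_append, List.reverse_append, List.reverse_singleton,
      List.singleton_append, List.prod_cons, Matrix.mul_apply, Matrix.sum_apply]
    simp only [Fin.val_last, Matrix.map_apply, Fin.val_castSucc]
    have hj : (Fin.castLE hm (Fin.last m)) = ⟨m, hmN⟩ := rfl
    have key : ∀ d : Fin 2,
        (atSite (Fin.castLE hm (Fin.last m)) (lOperator β x (t ((m : ℤ) + 1)) a d) *
          (List.ofFn fun j : Fin m => (lOperator β x (t (((j : ℕ) : ℤ) + 1))).map
            (atSite (Fin.castLE hm j.castSucc))).reverse.prod d c) b' b =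
        if ∀ l : Fin N, m + 1 ≤ l → b' l = b l then
          vertex β (ominus β x (t (m + 1))) (b' ⟨m, hmN⟩) (b ⟨m, hmN⟩) a d *
          rowMatrix β (fun s => ominus β x (t (s + 1))) (extendSpins b') (extendSpins b) m d c
        else 0 := by
      intro d
      have ih' := fun b' => ih (Nat.le_of_succ_le hm) d b'
      simp only [Fin.castLE_castSucc] at *
      -- The new factor changes only site m, and the remaining factors leave site m alone, so a
      -- single intermediate string survives.
      rw [Matrix.mul_apply, Finset.sum_eq_single (Function.update b' ⟨m, hmN⟩ (b ⟨m, hmN⟩))]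
      · rw [ih']
        have h1 : atSite (Fin.castLE hm (Fin.last m)) (lOperator β x (t ((m : ℤ) + 1)) a d) b'
            (Function.update b' ⟨m, hmN⟩ (b ⟨m, hmN⟩)) =
            vertex β (ominus β x (t (m + 1))) (b' ⟨m, hmN⟩) (b ⟨m, hmN⟩) a d := by
          rw [hj]
          simp only [atSite]
          rw [if_pos, lOperator_apply, Function.update_self]
          intro l hl
          rw [Function.update_of_ne hl]
        rw [h1]
        have h2 : (∀ l : Fin N, m ≤ l →
            Function.update b' ⟨m, hmN⟩ (b ⟨m, hmN⟩) l = b l) ↔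
            ∀ l : Fin N, m + 1 ≤ l → b' l = b l := by
          constructor
          · intro h l hl
            have := h l (by omega)
            rwa [Function.update_of_ne (by rintro rfl; simp at hl)] at this
          · intro h l hl
            by_cases hlm : l = ⟨m, hmN⟩
            · subst hlm; simp
            · rw [Function.update_of_ne hlm]
              exact h l (by
                have : (l : ℕ) ≠ m := fun h => hlm (Fin.ext h)
                omega)
        by_cases hc : ∀ l : Fin N, m + 1 ≤ l → b' l = b l
        · rw [if_pos (h2.2 hc), if_pos hc]
          refine congrArg (_ * ·) (congrFun (congrFun (rowMatrix_congr (fun _ _ => rfl)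
            (fun s hs => ?_) (fun _ _ => rfl)) d) c)
          rw [extendSpins_of_lt _ (by omega), extendSpins_of_lt _ (by omega),
            Function.update_of_ne]
          intro h
          have := congrArg Fin.val h
          simp at this; omega
        · rw [if_neg (fun h => hc (h2.1 h)), if_neg hc, mul_zero]
      · intro b'' _ hb''
        rw [ih']
        simp only [atSite, hj]
        split_ifs with h1 h2
        · exfalso
          apply hb''
          funext l
          by_cases hl : l = ⟨m, hmN⟩
          · subst hl; rw [Function.update_self]; exact h2 _ le_rfl
          · rw [Function.update_of_ne hl, h1 l hl]
        · simp
        · simp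
        · simp
      · simp
    rw [Finset.sum_congr rfl (fun d _ => key d)]
    split_ifs with h
    · rw [rowMatrix, Matrix.mul_apply, extendSpins_of_lt _ hmN, extendSpins_of_lt _ hmN]
    · simp

theorem monodromy_apply (β : K) (N : ℕ) (t : ℤ → K) (x : K) (a c : Fin 2) (b' b : Fin N → Fin 2) :
    monodromy β N t x a c b' b =
      rowMatrix β (fun s => ominus β x (t (s + 1))) (extendSpins b') (extendSpins b) N a c := by
  have := partial_monodromy_apply β x t N le_rfl a c b' b
  rw [if_pos fun l hl => absurd l.2 (by omega)] at this
  exact this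

end RowMatrix

/-! ### Particle hopping: one row acting on the state of a partition -/

section RowExpansion

variable {K : Type*} [Field K]

lemma rowMatrix_empty (β : K) (u : ℕ → K) (b' b : ℕ → Fin 2) (m : ℕ) (hb : ∀ s < m, b s = 0) :
    rowMatrix β u b' b m 1 0 = 0 ∧
    rowMatrix β u b' b m 0 0 = if ∀ s < m, b' s = 0 then ∏ s ∈ range m, u s else 0 := by
  induction m with
  | zero => simp [rowMatrix]
  | succ m ih =>
    obtain ⟨h1, h2⟩ := ih fun s hs => hb s (by omega)
    have hm := hb m (by omega)
    rcases Fin.exists_fin_two.1 ⟨b' m, rfl⟩ with h | h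
    · have e : (∀ s < m + 1, b' s = 0) ↔ ∀ s < m, b' s = 0 := by
        rw [Nat.forall_lt_succ_right]
        exact and_iff_left h
      simp only [rowMatrix, vertex, hm, h, Matrix.mul_apply, Fin.sum_univ_two, h1, h2, e,
        prod_range_succ]
      simp [mul_comm]
    · have e : ¬ ∀ s < m + 1, b' s = 0 := fun h' => by simp [h' m] at h
      simp only [rowMatrix, vertex, hm, h, Matrix.mul_apply, Fin.sum_univ_two, h1, h2, e]
      simp

/-- An occupied site is only reached by an empty auxiliary line. The particle either stays or is
lifted; once lifted it travels with weight 1 and is dropped at q with weight 1 + β u q, after which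
the empty line collects u at each empty site. The line leaves occupied exactly when there is no
drop. -/
lemma rowMatrix_top_particle (β : K) (u : ℕ → K) (b' b : ℕ → Fin 2) {p M : ℕ} (hM : p + 1 ≤ M)
    (hp : b p = 1) (hb : ∀ s, p < s → s < M → b s = 0) :
    rowMatrix β u b' b M 1 0 =
      (if ∀ s, p ≤ s → s < M → b' s = 0 then rowMatrix β u b' b p 0 0 else 0) ∧
    rowMatrix β u b' b M 0 0 =
      ∑ q ∈ Ico p M, if ∀ s, p ≤ s → s < M → b' s = if s = q then 1 else 0 then
        (if q = p then 1 else 1 + β * u q) * (∏ s ∈ Ioo q M, u s) * rowMatrix β u b' b p 0 0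
      else 0 := by
  induction M, hM using Nat.le_induction with
  | base =>
    have e : ∀ P : ℕ → Prop, (∀ s, p ≤ s → s < p + 1 → P s) ↔ P p := fun P =>
      ⟨fun h => h p le_rfl (by omega), fun h s h1 h2 => by
        obtain rfl : s = p := by omega
        exact h⟩
    rw [Nat.Ico_succ_singleton, sum_singleton]
    have e2 : Ioo p (p + 1) = ∅ := by ext; simp
    simp only [e, rowMatrix, vertex, hp, e2]
    rcases Fin.exists_fin_two.1 ⟨b' p, rfl⟩ with h | h <;>
      simp [h, Matrix.mul_apply, Fin.sum_univ_two]
  | succ M hM ih =>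
    obtain ⟨h1, h2⟩ := ih fun s hs hs' => hb s hs (by omega)
    have hm := hb M (by omega) (by omega)
    have e : ∀ P : ℕ → Prop, (∀ s, p ≤ s → s < M + 1 → P s) ↔
        (∀ s, p ≤ s → s < M → P s) ∧ P M := fun P =>
      ⟨fun h => ⟨fun s h1 h2 => h s h1 (by omega), h M (by omega) (by omega)⟩,
        fun h s h1 h2 => by
          rcases Nat.lt_succ_iff_lt_or_eq.1 h2 with h3 | rfl
          · exact h.1 s h1 h3
          · exact h.2⟩
    have hIoo : ∀ q ∈ Ico p M, ∏ s ∈ Ioo q (M + 1), u s = (∏ s ∈ Ioo q M, u s) * u M := by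
      intro q hq
      rw [mem_Ico] at hq
      have : Ioo q (M + 1) = insert M (Ioo q M) := by ext; simp; omega
      rw [this, prod_insert (by simp), mul_comm]
    have hne : ∀ q ∈ Ico p M, M ≠ q := fun q hq => by rw [mem_Ico] at hq; omega
    rw [Finset.sum_Ico_succ_top (by omega)]
    simp only [e]
    rcases Fin.exists_fin_two.1 ⟨b' M, rfl⟩ with h | h
    · refine ⟨?_, ?_⟩
      · simp [rowMatrix, vertex, hm, h, Matrix.mul_apply, Fin.sum_univ_two, h1]
      · have : rowMatrix β u b' b (M + 1) 0 0 = u M * rowMatrix β u b' b M 0 0 := by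
          simp [rowMatrix, vertex, hm, h, Matrix.mul_apply, Fin.sum_univ_two]
        rw [this, h2, mul_sum, h]
        simp only [if_true, zero_ne_one, and_false, if_false, add_zero]
        refine sum_congr rfl fun q hq => ?_
        rw [if_neg (hne q hq), hIoo q hq]
        simp only [and_true, mul_ite, mul_zero]
        exact if_congr Iff.rfl (by ring) rfl
    · refine ⟨?_, ?_⟩
      · simp [rowMatrix, vertex, hm, h, Matrix.mul_apply, Fin.sum_univ_two]
      · have : rowMatrix β u b' b (M + 1) 0 0 = (1 + β * u M) * rowMatrix β u b' b M 1 0 := by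
          simp [rowMatrix, vertex, hm, h, Matrix.mul_apply, Fin.sum_univ_two]
        rw [this, h1, h, sum_eq_zero, zero_add]
        · have e2 : Ioo M (M + 1) = ∅ := by ext; simp
          have e3 : (∀ s, p ≤ s → s < M → b' s = if s = M then 1 else 0) ↔
              ∀ s, p ≤ s → s < M → b' s = 0 := by
            refine forall_congr' fun s => imp_congr_right fun _ => forall_congr' fun hs => ?_
            rw [if_neg hs.ne]
          simp only [e3, if_true, and_true, e2, prod_empty, mul_one,
            if_neg (show M ≠ p by omega), mul_ite, mul_zero]
        · intro q hq
          rw [if_neg (hne q hq)]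
          simp

/-- The spins of the state of a partition: the part `ν i` puts a `1` at the site `ν i + rev i`
(sites are counted from 0). -/
def spins {n : ℕ} (ν : Fin n → ℕ) (s : ℕ) : Fin 2 := if ∃ i, s = ν i + (i.rev : ℕ) then 1 else 0

/-- The partitions `ν` obtained from `κ` by removing a horizontal strip and the last part. -/
def interlacing {n : ℕ} (κ : Fin (n + 1) → ℕ) : Finset (Fin n → ℕ) :=
  Fintype.piFinset fun i => Icc (κ i.succ) (κ i.castSucc)

/-- The coefficient of `ν` in the branching of `κ`. -/
def rowWeight (β : K) (u : ℕ → K) {n : ℕ} (κ : Fin (n + 1) → ℕ) (ν : Fin n → ℕ) : K :=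
  (∏ i : Fin n, (if ν i = κ i.succ then 1 else 1 + β * u (ν i + i.rev)) *
    ∏ j ∈ Ico (ν i) (κ i.castSucc), u (j + i.rev + 1)) * ∏ j ∈ range (κ (Fin.last n)), u j

lemma spins_cons {n : ℕ} (q : ℕ) (ν : Fin n → ℕ) (s : ℕ) :
    spins (Fin.cons q ν : Fin (n + 1) → ℕ) s = if s = q + n then 1 else spins ν s := by
  simp only [spins, Fin.exists_fin_succ, Fin.cons_zero, Fin.cons_succ, Fin.rev_zero, Fin.val_last,
    Fin.rev_succ, Fin.val_castSucc]
  split_ifs <;> simp_all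

lemma spins_eq_zero {n m : ℕ} {ν : Fin n → ℕ} (h : ∀ i, ν i ≤ m) {s : ℕ} (hs : m + n ≤ s) :
    spins ν s = 0 := by
  rw [spins, if_neg]
  rintro ⟨i, rfl⟩
  have := h i
  have := i.rev.2
  omega

lemma sum_interlacing_succ {n : ℕ} (κ : Fin (n + 2) → ℕ) (f : (Fin (n + 1) → ℕ) → K) :
    ∑ ν ∈ interlacing κ, f ν =
      ∑ q ∈ Icc (κ 1) (κ 0), ∑ ν ∈ interlacing (Fin.tail κ), f (Fin.cons q ν) := by
  rw [← sum_product']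
  refine sum_nbij' (fun ν => (ν 0, Fin.tail ν)) (fun p => Fin.cons p.1 p.2) ?_ ?_ ?_ ?_ ?_
  · intro ν hν
    rw [interlacing, Fintype.mem_piFinset] at hν
    rw [mem_product, interlacing, Fintype.mem_piFinset]
    exact ⟨hν 0, fun i => hν i.succ⟩
  · rintro ⟨q, ν⟩ h
    rw [mem_product, interlacing, Fintype.mem_piFinset] at h
    rw [interlacing, Fintype.mem_piFinset]
    exact Fin.cases h.1 h.2
  · intro ν _; simp
  · rintro ⟨q, ν⟩ _; simp
  · intro ν _; simp

lemma rowWeight_cons (β : K) (u : ℕ → K) {n : ℕ} (κ : Fin (n + 2) → ℕ) (q : ℕ) (ν : Fin n → ℕ) :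
    rowWeight β u κ (Fin.cons q ν) =
      (if q = κ 1 then 1 else 1 + β * u (q + n)) * (∏ j ∈ Ico q (κ 0), u (j + n + 1)) *
        rowWeight β u (Fin.tail κ) ν := by
  simp only [rowWeight, Fin.prod_univ_succ, Fin.cons_zero, Fin.cons_succ, Fin.rev_zero,
    Fin.val_last, Fin.rev_succ, Fin.val_castSucc, Fin.tail, Fin.succ_last, Fin.succ_zero_eq_one,
    Fin.castSucc_zero, Fin.succ_castSucc, mul_assoc]
  rfl

/-- The particles of `Fin.tail κ` move independently between their own position and the old position
of the next one; for the top particle the end of the row at `κ 0 + n` plays that role. Induction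
peels off the top particle. -/
theorem rowMatrix_spins_zero_zero (β : K) (u : ℕ → K) {n : ℕ} (κ : Fin (n + 1) → ℕ)
    (hκ : Antitone κ) (b' : ℕ → Fin 2) :
    rowMatrix β u b' (spins (Fin.tail κ)) (κ 0 + n) 0 0 =
      ∑ ν ∈ interlacing κ, if ∀ s < κ 0 + n, b' s = spins ν s then rowWeight β u κ ν else 0 := by
  induction n with
  | zero =>
    have h0 : ∀ (ν : Fin 0 → ℕ) s, spins ν s = 0 := fun ν s => by simp [spins]
    rw [(rowMatrix_empty β u b' _ _ fun s _ => h0 _ s).2, interlacing, Fintype.piFinset_of_isEmpty]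
    simp [h0, rowWeight]
  | succ n ih =>
    have hκ' : Antitone (Fin.tail κ) := fun i j h => hκ (Fin.succ_le_succ_iff.2 h)
    have h10 : κ 1 ≤ κ 0 := hκ (Fin.zero_le _)
    have htail : Fin.tail κ = Fin.cons (κ 1) (Fin.tail (Fin.tail κ)) := by
      conv_lhs => rw [← Fin.cons_self_tail (Fin.tail κ)]
      rfl
    have hle : ∀ i, Fin.tail (Fin.tail κ) i ≤ κ 1 := fun i => hκ' (Fin.zero_le i.succ)
    rw [(rowMatrix_top_particle β u b' (spins (Fin.tail κ)) (p := κ 1 + n) (by omega) ?_ ?_).2,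
      sum_interlacing_succ]
    · have hA : rowMatrix β u b' (spins (Fin.tail κ)) (κ 1 + n) 0 0 =
          rowMatrix β u b' (spins (Fin.tail (Fin.tail κ))) (Fin.tail κ 0 + n) 0 0 := by
        refine congrFun (congrFun (rowMatrix_congr (fun _ _ => rfl) (fun _ _ => rfl)
          fun s hs => ?_) 0) 0
        rw [htail, spins_cons, if_neg (by omega)]
        rfl
      -- The part q of the top particle sits at site q + n, hence the shift of the summation range.
      rw [hA, ih (Fin.tail κ) hκ', ← Finset.Ico_add_one_right_eq_Icc,
        show κ 0 + (n + 1) = (κ 0 + 1) + n by ring, ← sum_Ico_add' _ (κ 1) (κ 0 + 1) n]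
      refine sum_congr rfl fun q hq => ?_
      rw [mem_Ico] at hq
      have hprod : ∏ s ∈ Ioo (q + n) (κ 0 + 1 + n), u s = ∏ j ∈ Ico q (κ 0), u (j + n + 1) := by
        have := prod_Ico_add' u q (κ 0) (n + 1)
        simp only [← add_assoc] at this
        rw [this]
        refine prod_congr ?_ fun _ _ => rfl
        ext; simp; omega
      have hcond : ∀ ν ∈ interlacing (Fin.tail κ),
          ((∀ s < κ 0 + 1 + n, b' s = spins (Fin.cons q ν : Fin (n + 1) → ℕ) s) ↔
            (∀ s, κ 1 + n ≤ s → s < κ 0 + 1 + n → b' s = if s = q + n then 1 else 0) ∧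
            ∀ s < κ 1 + n, b' s = spins ν s) := by
        intro ν hν
        rw [interlacing, Fintype.mem_piFinset] at hν
        have hν' : ∀ i, ν i ≤ κ 1 := fun i =>
          (mem_Icc.1 (hν i)).2.trans (hκ' (Fin.zero_le _))
        simp only [spins_cons]
        constructor
        · intro h
          refine ⟨fun s h1 h2 => ?_, fun s hs => ?_⟩
          · rw [h s h2, spins_eq_zero hν' h1]
          · rw [h s (by omega), if_neg (by omega)]
        · rintro ⟨h1, h2⟩ s hs
          by_cases h3 : s < κ 1 + n
          · rw [h2 s h3, if_neg (by omega)]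
          · rw [h1 s (by omega) hs, spins_eq_zero hν' (by omega)]
      refine Eq.trans ?_ (sum_congr rfl fun ν hν => (if_congr (hcond ν hν) rfl rfl).symm)
      rw [hprod]
      simp only [add_left_inj, rowWeight_cons]
      by_cases h1 : ∀ s, κ 1 + n ≤ s → s < κ 0 + 1 + n → b' s = if s = q + n then 1 else 0
      · simp_rw [if_pos h1, and_iff_right h1, mul_sum, mul_ite, mul_zero]
        rfl
      · simp [h1]
    · rw [htail, spins_cons, if_pos rfl]
    · intro s h1 h2
      rw [htail, spins_cons, if_neg (by omega), spins_eq_zero hle (by omega)]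

/-- The top particle, at site `κ 0 + n`, has to be lifted for good, so the row splits into the row
below it and trivial weights above. -/
theorem rowMatrix_spins_one_zero (β : K) (u : ℕ → K) {n N : ℕ} (κ : Fin (n + 1) → ℕ)
    (hκ : Antitone κ) (hN : κ 0 + n < N) (b' : ℕ → Fin 2) :
    rowMatrix β u b' (spins κ) N 1 0 =
      ∑ ν ∈ interlacing κ, if ∀ s < N, b' s = spins ν s then rowWeight β u κ ν else 0 := by
  have hle : ∀ i, Fin.tail κ i ≤ κ 0 := fun i => hκ (Fin.zero_le _)
  have hcons : spins κ = spins (Fin.cons (κ 0) (Fin.tail κ)) := by rw [Fin.cons_self_tail]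
  rw [(rowMatrix_top_particle β u b' (spins κ) hN ?_ ?_).1]
  · have hA : rowMatrix β u b' (spins κ) (κ 0 + n) 0 0 =
        rowMatrix β u b' (spins (Fin.tail κ)) (κ 0 + n) 0 0 := by
      refine congrFun (congrFun (rowMatrix_congr (fun _ _ => rfl) (fun _ _ => rfl)
        fun s hs => ?_) 0) 0
      rw [hcons, spins_cons, if_neg (by omega)]
    rw [hA, rowMatrix_spins_zero_zero β u κ hκ]
    have hcond : ∀ ν ∈ interlacing κ, ((∀ s < N, b' s = spins ν s) ↔
        (∀ s, κ 0 + n ≤ s → s < N → b' s = 0) ∧ ∀ s < κ 0 + n, b' s = spins ν s) := by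
      intro ν hν
      rw [interlacing, Fintype.mem_piFinset] at hν
      have hν' : ∀ i, ν i ≤ κ 0 := fun i => (mem_Icc.1 (hν i)).2.trans (hκ (Fin.zero_le _))
      constructor
      · intro h
        exact ⟨fun s h1 h2 => by rw [h s h2, spins_eq_zero hν' h1], fun s hs => h s (by omega)⟩
      · rintro ⟨h1, h2⟩ s hs
        by_cases h3 : s < κ 0 + n
        · exact h2 s h3
        · rw [h1 s (by omega) hs, spins_eq_zero hν' (by omega)]
    refine Eq.trans ?_ (sum_congr rfl fun ν hν => (if_congr (hcond ν hν) rfl rfl).symm)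
    split_ifs with h
    · simp_rw [and_iff_right h]
    · simp [h]
  · rw [hcons, spins_cons, if_pos rfl]
  · intro s h1 h2
    rw [hcons, spins_cons, if_neg (by omega), spins_eq_zero hle (by omega)]

end RowExpansion

/-! ### Deleting the largest entry of a set-valued tableau -/

section TableauBranching

variable {K : Type*} [Field K]

lemma mem_SVT {n : ℕ} {θ : Finset (ℕ × ℕ)} {T : θ → Finset (Fin n)} :
    T ∈ SVT n θ ↔ IsSetValuedTableau θ T := by
  simp [SVT]

/-- The generating function of set-valued tableaux for a weight depending on the entry and the
box. -/
def tableauSum (β : K) {n : ℕ} (θ : Finset (ℕ × ℕ)) (w : Fin n → ℕ × ℕ → K) : K :=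
  ∑ T ∈ SVT n θ, ∏ c : θ, (β ^ (#(T c) - 1) * ∏ r ∈ T c, w r c)

/-- All the sets are nonempty, so the excess |T| − |θ| is the sum of the excesses of the boxes and
the truncated subtractions are exact. -/
lemma groth_eq_tableauSum (β : K) {n : ℕ} (θ : Finset (ℕ × ℕ)) (x : Fin n → K) (t : ℤ → K) :
    groth β θ x t = tableauSum β θ fun r c =>
      oplus β (x r) (t (((r : ℕ) : ℤ) + (c.2 : ℤ) - (c.1 : ℤ) + 1)) := by
  refine sum_congr rfl fun T hT => ?_
  rw [prod_mul_distrib, prod_pow_eq_pow_sum]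
  congr 2
  have h1 : ∀ c, 1 ≤ #(T c) := fun c => card_pos.2 ((mem_SVT.1 hT).1 c)
  have h2 : ∑ c, #(T c) = ∑ c, (#(T c) - 1) + #θ := by
    rw [← Fintype.card_coe θ, Fintype.card, card_eq_sum_ones, ← sum_add_distrib]
    exact sum_congr rfl fun c _ => (Nat.sub_add_cancel (h1 c)).symm
  omega

/-- The boxes with an entry smaller than the largest possible one. -/
def core {n : ℕ} {θ : Finset (ℕ × ℕ)} (T : θ → Finset (Fin (n + 1))) : Finset (ℕ × ℕ) :=
  (univ.filter fun c : θ => T c ≠ {Fin.last n}).map (Function.Embedding.subtype _)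

lemma mem_core {n : ℕ} {θ : Finset (ℕ × ℕ)} {T : θ → Finset (Fin (n + 1))} {c : ℕ × ℕ}
    (h : c ∈ θ) : c ∈ core T ↔ T ⟨c, h⟩ ≠ {Fin.last n} := by
  simp [core, h]

lemma core_subset {n : ℕ} {θ : Finset (ℕ × ℕ)} (T : θ → Finset (Fin (n + 1))) : core T ⊆ θ := by
  intro c
  simp only [core, mem_map, mem_filter, Function.Embedding.subtype_apply]
  rintro ⟨d, _, rfl⟩
  exact d.2

/-- The boxes of `θ` outside `ν` form a horizontal strip at the right end of the rows. -/
def IsHorizontalStripCompl (θ ν : Finset (ℕ × ℕ)) : Prop :=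
  ∀ c ∈ θ, c ∉ ν → (c.1, c.2 + 1) ∉ ν ∧ (c.1 + 1, c.2) ∉ θ

instance (θ ν : Finset (ℕ × ℕ)) : Decidable (IsHorizontalStripCompl θ ν) := by
  unfold IsHorizontalStripCompl; infer_instance

/-- The boxes of `ν` to which the largest entry can be added. -/
def freeCorners (θ ν : Finset (ℕ × ℕ)) : Finset (ℕ × ℕ) :=
  ν.filter fun c => (c.1, c.2 + 1) ∉ ν ∧ (c.1 + 1, c.2) ∉ θ

/-- Removal of the largest entry. -/
def restrictTableau {n : ℕ} {θ ν : Finset (ℕ × ℕ)} (h : ν ⊆ θ) (T : θ → Finset (Fin (n + 1))) :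
    ν → Finset (Fin n) :=
  fun c => univ.filter fun r => r.castSucc ∈ T ⟨c, h c.2⟩

/-- The boxes of `ν` with the largest entry. -/
def lastBoxes {n : ℕ} {θ ν : Finset (ℕ × ℕ)} (h : ν ⊆ θ) (T : θ → Finset (Fin (n + 1))) :
    Finset (ℕ × ℕ) :=
  (univ.filter fun c : ν => Fin.last n ∈ T ⟨c, h c.2⟩).map (Function.Embedding.subtype _)

/-- Insertion of the largest entry into the boxes of `X` and the boxes outside `ν`. -/
def extendTableau {n : ℕ} (θ : Finset (ℕ × ℕ)) {ν : Finset (ℕ × ℕ)} (T : ν → Finset (Fin n))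
    (X : Finset (ℕ × ℕ)) : θ → Finset (Fin (n + 1)) :=
  fun c => if h : c.1 ∈ ν then
    (T ⟨c, h⟩).map Fin.castSuccEmb ∪ (if c.1 ∈ X then {Fin.last n} else ∅)
  else {Fin.last n}

lemma mem_lastBoxes {n : ℕ} {θ ν : Finset (ℕ × ℕ)} {h : ν ⊆ θ} {T : θ → Finset (Fin (n + 1))}
    {c : ℕ × ℕ} (hc : c ∈ ν) : c ∈ lastBoxes h T ↔ Fin.last n ∈ T ⟨c, h hc⟩ := by
  simp [lastBoxes, hc]

lemma lastBoxes_subset {n : ℕ} {θ ν : Finset (ℕ × ℕ)} (h : ν ⊆ θ)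
    (T : θ → Finset (Fin (n + 1))) : lastBoxes h T ⊆ ν := by
  intro c
  simp only [lastBoxes, mem_map, mem_filter, Function.Embedding.subtype_apply]
  rintro ⟨d, _, rfl⟩
  exact d.2

lemma castSucc_mem_extendTableau {n : ℕ} {θ ν : Finset (ℕ × ℕ)} {T : ν → Finset (Fin n)}
    {X : Finset (ℕ × ℕ)} {c : θ} {r : Fin n} :
    r.castSucc ∈ extendTableau θ T X c ↔ ∃ h : c.1 ∈ ν, r ∈ T ⟨c, h⟩ := by
  have h0 := (Fin.castSucc_lt_last r).ne
  unfold extendTableau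
  split_ifs <;> simp_all

lemma last_mem_extendTableau {n : ℕ} {θ ν : Finset (ℕ × ℕ)} {T : ν → Finset (Fin n)}
    {X : Finset (ℕ × ℕ)} {c : θ} :
    Fin.last n ∈ extendTableau θ T X c ↔ c.1 ∉ ν ∨ c.1 ∈ X := by
  unfold extendTableau
  split_ifs <;> simp_all

/-- A box containing the largest entry forces that entry alone in its right neighbour and forbids a
box below. -/
lemma isHorizontalStripCompl_core {n : ℕ} {θ : Finset (ℕ × ℕ)} {T : θ → Finset (Fin (n + 1))}
    (hT : IsSetValuedTableau θ T) : IsHorizontalStripCompl θ (core T) := by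
  intro c hc hcT
  rw [mem_core hc, not_not] at hcT
  constructor
  · intro hr
    have hr' := core_subset T hr
    rw [mem_core hr'] at hr
    refine hr (eq_singleton_iff_nonempty_unique_mem.2 ⟨hT.1 _, fun b hb => ?_⟩)
    exact le_antisymm (Fin.le_last _) (hT.2.1 ⟨c, hc⟩ ⟨_, hr'⟩ rfl _ (by rw [hcT]; simp) b hb)
  · intro hb
    obtain ⟨b, hb'⟩ := hT.1 ⟨_, hb⟩
    exact absurd (hT.2.2 ⟨c, hc⟩ ⟨_, hb⟩ rfl (Fin.last n) (by rw [hcT]; simp) b hb')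
      (not_lt.2 (Fin.le_last _))

lemma isSetValuedTableau_restrict {n : ℕ} {θ : Finset (ℕ × ℕ)} {T : θ → Finset (Fin (n + 1))}
    (hT : IsSetValuedTableau θ T) :
    IsSetValuedTableau (core T) (restrictTableau (core_subset T) T) := by
  refine ⟨fun c => ?_, fun c d h a ha b hb => ?_, fun c d h a ha b hb => ?_⟩
  · have hc := (mem_core (core_subset T c.2)).1 c.2
    by_contra hne
    rw [not_nonempty_iff_eq_empty, restrictTableau, filter_eq_empty_iff] at hne
    refine hc (eq_singleton_iff_nonempty_unique_mem.2 ⟨hT.1 _, fun b hb => ?_⟩)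
    rcases Fin.eq_castSucc_or_eq_last b with ⟨r, rfl⟩ | h
    · exact absurd hb (hne (mem_univ r))
    · exact h
  · simp only [restrictTableau, mem_filter, mem_univ, true_and] at ha hb
    exact Fin.castSucc_le_castSucc_iff.1 (hT.2.1 _ _ h _ ha _ hb)
  · simp only [restrictTableau, mem_filter, mem_univ, true_and] at ha hb
    exact Fin.castSucc_lt_castSucc_iff.1 (hT.2.2 _ _ h _ ha _ hb)

lemma lastBoxes_subset_freeCorners {n : ℕ} {θ : Finset (ℕ × ℕ)} {T : θ → Finset (Fin (n + 1))}
    (hT : IsSetValuedTableau θ T) :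
    lastBoxes (core_subset T) T ⊆ freeCorners θ (core T) := by
  intro c hc
  have hcT := lastBoxes_subset _ _ hc
  rw [mem_lastBoxes hcT] at hc
  rw [freeCorners, mem_filter]
  refine ⟨hcT, fun hr => ?_, fun hb => ?_⟩
  · have hr' := core_subset T hr
    rw [mem_core hr'] at hr
    refine hr (eq_singleton_iff_nonempty_unique_mem.2 ⟨hT.1 _, fun b hb => ?_⟩)
    exact le_antisymm (Fin.le_last _)
      (hT.2.1 ⟨c, core_subset T hcT⟩ ⟨_, hr'⟩ rfl _ hc b hb)
  · obtain ⟨b, hb'⟩ := hT.1 ⟨_, hb⟩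
    exact absurd (hT.2.2 ⟨c, core_subset T hcT⟩ ⟨_, hb⟩ rfl (Fin.last n) hc b hb')
      (not_lt.2 (Fin.le_last _))

lemma isSetValuedTableau_extend {n : ℕ} {θ ν : Finset (ℕ × ℕ)} (hs : IsHorizontalStripCompl θ ν)
    {T : ν → Finset (Fin n)} (hT : IsSetValuedTableau ν T)
    {X : Finset (ℕ × ℕ)} (hX : X ⊆ freeCorners θ ν) :
    IsSetValuedTableau θ (extendTableau θ T X) := by
  refine ⟨fun c => ?_, fun c d h a ha b hb => ?_, fun c d h a ha b hb => ?_⟩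
  · by_cases hc : c.1 ∈ ν
    · obtain ⟨r, hr⟩ := hT.1 ⟨c, hc⟩
      exact ⟨_, castSucc_mem_extendTableau.2 ⟨hc, hr⟩⟩
    · exact ⟨_, last_mem_extendTableau.2 (Or.inl hc)⟩
  · rcases Fin.eq_castSucc_or_eq_last b with ⟨b, rfl⟩ | rfl
    · obtain ⟨hd, hb⟩ := castSucc_mem_extendTableau.1 hb
      rcases Fin.eq_castSucc_or_eq_last a with ⟨a, rfl⟩ | rfl
      · obtain ⟨hc, ha⟩ := castSucc_mem_extendTableau.1 ha
        exact Fin.castSucc_le_castSucc_iff.2 (hT.2.1 ⟨c, hc⟩ ⟨d, hd⟩ h a ha b hb)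
      · exfalso
        rw [h] at hd
        rcases last_mem_extendTableau.1 ha with h1 | h1
        · exact (hs c.1 c.2 h1).1 hd
        · exact (mem_filter.1 (hX h1)).2.1 hd
    · exact Fin.le_last _
  · rcases Fin.eq_castSucc_or_eq_last a with ⟨a, rfl⟩ | rfl
    · rcases Fin.eq_castSucc_or_eq_last b with ⟨b, rfl⟩ | rfl
      · obtain ⟨hd, hb⟩ := castSucc_mem_extendTableau.1 hb
        obtain ⟨hc, ha⟩ := castSucc_mem_extendTableau.1 ha
        exact Fin.castSucc_lt_castSucc_iff.2 (hT.2.2 ⟨c, hc⟩ ⟨d, hd⟩ h a ha b hb)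
      · exact Fin.castSucc_lt_last _
    · exfalso
      have hd := d.2
      rw [h] at hd
      rcases last_mem_extendTableau.1 ha with h1 | h1
      · exact (hs c.1 c.2 h1).2 hd
      · exact (mem_filter.1 (hX h1)).2.2 hd

lemma core_extendTableau {n : ℕ} {θ ν : Finset (ℕ × ℕ)} (hν : ν ⊆ θ)
    {T : ν → Finset (Fin n)} (hT : IsSetValuedTableau ν T) (X : Finset (ℕ × ℕ)) :
    core (extendTableau θ T X) = ν := by
  ext c
  constructor
  · intro hc
    have hc' := core_subset _ hc
    rw [mem_core hc'] at hc
    by_contra h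
    exact hc (by simp [extendTableau, h])
  · intro hc
    rw [mem_core (hν hc)]
    obtain ⟨r, hr⟩ := hT.1 ⟨c, hc⟩
    intro h
    have : r.castSucc ∈ extendTableau θ T X ⟨c, hν hc⟩ :=
      castSucc_mem_extendTableau.2 ⟨hc, hr⟩
    rw [h, mem_singleton] at this
    exact (Fin.castSucc_lt_last r).ne this

lemma prod_extendTableau (β : K) {n : ℕ} {θ ν : Finset (ℕ × ℕ)} (hν : ν ⊆ θ)
    {T : ν → Finset (Fin n)} (hT : IsSetValuedTableau ν T) {X : Finset (ℕ × ℕ)} (hX : X ⊆ ν)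
    (w : Fin (n + 1) → ℕ × ℕ → K) :
    ∏ c : θ, (β ^ (#(extendTableau θ T X c) - 1) * ∏ r ∈ extendTableau θ T X c, w r c) =
      (∏ c ∈ θ \ ν, w (Fin.last n) c) * (∏ c ∈ X, β * w (Fin.last n) c) *
        ∏ c : ν, (β ^ (#(T c) - 1) * ∏ r ∈ T c, w r.castSucc c) := by
  set g : ℕ × ℕ → K := fun c => if h : c ∈ ν then
    (β ^ (#(T ⟨c, h⟩) - 1) * ∏ r ∈ T ⟨c, h⟩, w r.castSucc c) else 1 with hg
  have h1 : ∀ c : θ, β ^ (#(extendTableau θ T X c) - 1) * ∏ r ∈ extendTableau θ T X c, w r c =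
      (if c.1 ∈ ν then 1 else w (Fin.last n) c) * (if c.1 ∈ X then β * w (Fin.last n) c else 1) *
        g c := by
    intro c
    by_cases hc : c.1 ∈ ν
    · have hpos := card_pos.2 (hT.1 ⟨c, hc⟩)
      by_cases hcX : c.1 ∈ X
      · have hd : Disjoint ((T ⟨c, hc⟩).map Fin.castSuccEmb) {Fin.last n} := by
          rw [disjoint_singleton_right, mem_map]
          rintro ⟨r, _, hr⟩
          exact (Fin.castSucc_lt_last r).ne hr
        simp only [extendTableau, hc, hcX, if_true, dif_pos, hg]
        rw [prod_union hd, card_union_of_disjoint hd, card_map, card_singleton, prod_map,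
          prod_singleton, Nat.add_sub_cancel]
        obtain ⟨m, hm⟩ : ∃ m, #(T ⟨c, hc⟩) = m + 1 := ⟨_, (Nat.sub_add_cancel hpos).symm⟩
        rw [hm, Nat.add_sub_cancel, pow_succ]
        simp only [Fin.castSuccEmb_apply]
        ring
      · simp [extendTableau, hc, hcX, hg, prod_map]
    · have hcX : c.1 ∉ X := fun h => hc (hX h)
      simp [extendTableau, hc, hcX, hg]
  rw [prod_congr rfl fun c _ => h1 c, prod_coe_sort θ (fun c : ℕ × ℕ =>
    (if c ∈ ν then 1 else w (Fin.last n) c) * (if c ∈ X then β * w (Fin.last n) c else 1) * g c),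
    prod_mul_distrib, prod_mul_distrib]
  congr 1
  · congr 1
    · rw [sdiff_eq_filter, prod_filter]
      exact prod_congr rfl fun c _ => by by_cases h : c ∈ ν <;> simp [h]
    · rw [← prod_filter, filter_mem_eq_inter, inter_eq_right.2 (hX.trans hν)]
  · rw [← prod_subset hν (fun c _ hc => by simp [hg, hc]), ← prod_coe_sort]
    exact prod_congr rfl fun c _ => by simp [hg]

/-- Over a fixed core ν, a tableau is a tableau on ν together with an arbitrary set X of free
corners that also receive the largest entry. Summing the weights β w over all X gives the product of
the factors 1 + β w. -/
theorem tableauSum_succ (β : K) {n : ℕ} (θ : Finset (ℕ × ℕ)) (w : Fin (n + 1) → ℕ × ℕ → K) :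
    tableauSum β θ w = ∑ ν ∈ θ.powerset.filter (IsHorizontalStripCompl θ),
      (∏ c ∈ θ \ ν, w (Fin.last n) c) * (∏ c ∈ freeCorners θ ν, (1 + β * w (Fin.last n) c)) *
        tableauSum β ν fun r => w r.castSucc := by
  rw [tableauSum, ← sum_fiberwise_of_maps_to (g := core)
    (t := θ.powerset.filter (IsHorizontalStripCompl θ))]
  · refine sum_congr rfl fun ν hν => ?_
    rw [mem_filter, mem_powerset] at hν
    obtain ⟨hν, hs⟩ := hν
    rw [prod_one_add, mul_assoc, sum_mul, mul_sum]
    simp_rw [tableauSum, mul_sum]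
    rw [← sum_product']
    refine (sum_bij' (fun p _ => extendTableau θ p.2 p.1)
      (fun T _ => (lastBoxes hν T, restrictTableau hν T)) ?_ ?_ ?_ ?_ ?_).symm
    · rintro ⟨X, T⟩ h
      rw [mem_product, mem_powerset, mem_SVT] at h
      rw [mem_filter, mem_SVT]
      exact ⟨isSetValuedTableau_extend hs h.2 h.1, core_extendTableau hν h.2 X⟩
    · intro T hT
      rw [mem_filter, mem_SVT] at hT
      obtain ⟨hT, rfl⟩ := hT
      rw [mem_product, mem_powerset, mem_SVT]
      exact ⟨lastBoxes_subset_freeCorners hT, isSetValuedTableau_restrict hT⟩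
    · rintro ⟨X, T⟩ h
      rw [mem_product, mem_powerset, mem_SVT] at h
      have hX : X ⊆ ν := h.1.trans (filter_subset _ _)
      refine Prod.ext ?_ ?_
      · ext c
        constructor
        · intro hc
          have hc' := lastBoxes_subset hν _ hc
          rw [mem_lastBoxes hc', last_mem_extendTableau] at hc
          exact hc.resolve_left (not_not.2 hc')
        · intro hc
          rw [mem_lastBoxes (hX hc), last_mem_extendTableau]
          exact Or.inr hc
      · funext c
        ext r
        simp [restrictTableau, castSucc_mem_extendTableau]
    · intro T hT
      rw [mem_filter, mem_SVT] at hT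
      obtain ⟨hT, rfl⟩ := hT
      funext c
      ext r
      rcases Fin.eq_castSucc_or_eq_last r with ⟨r, rfl⟩ | rfl
      · rw [castSucc_mem_extendTableau]
        simp only [restrictTableau, mem_filter, mem_univ, true_and]
        refine ⟨fun h => h.2, fun h => ⟨?_, h⟩⟩
        rw [mem_core c.2]
        intro h'
        rw [h', mem_singleton] at h
        exact (Fin.castSucc_lt_last r).ne h
      · rw [last_mem_extendTableau]
        constructor
        · rintro (h | h)
          · rw [mem_core c.2, not_not] at h
            rw [h, mem_singleton]
          · exact (mem_lastBoxes (h := hν) (lastBoxes_subset hν _ h)).1 h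
        · intro h
          by_cases hc : c.1 ∈ core T
          · exact Or.inr ((mem_lastBoxes (h := hν) hc).2 h)
          · exact Or.inl hc
    · rintro ⟨X, T⟩ h
      rw [mem_product, mem_powerset, mem_SVT] at h
      rw [prod_extendTableau β hν h.2 (h.1.trans (filter_subset _ _)), mul_assoc]
  · intro T hT
    rw [mem_SVT] at hT
    rw [mem_filter, mem_powerset]
    exact ⟨core_subset T, isHorizontalStripCompl_core hT⟩

end TableauBranching

/-! ### Branching of factorial Grothendieck polynomials of partitions -/

section ShapeBranching

variable {K : Type*} [Field K]

/-- The Young diagram with row lengths `ν`. -/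
def shape {n : ℕ} (ν : Fin n → ℕ) : Finset (ℕ × ℕ) :=
  (univ : Finset (Fin n)).biUnion fun i => (range (ν i)).image fun j => ((i : ℕ), j)

lemma mem_shape {n : ℕ} {ν : Fin n → ℕ} {c : ℕ × ℕ} :
    c ∈ shape ν ↔ ∃ h : c.1 < n, c.2 < ν ⟨c.1, h⟩ := by
  simp only [shape, mem_biUnion, mem_univ, true_and, mem_image, mem_range]
  constructor
  · rintro ⟨i, j, hj, rfl⟩
    exact ⟨i.2, hj⟩
  · rintro ⟨h, hj⟩
    exact ⟨⟨c.1, h⟩, c.2, hj, rfl⟩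

lemma mk_mem_shape {n : ℕ} {ν : Fin n → ℕ} {i : Fin n} {j : ℕ} :
    ((i : ℕ), j) ∈ shape ν ↔ j < ν i := by
  rw [mem_shape]
  exact ⟨fun ⟨_, h⟩ => h, fun h => ⟨i.2, h⟩⟩

lemma shape_injective {n : ℕ} : Function.Injective (shape (n := n)) := by
  intro ν ν' h
  funext i
  have h1 : ∀ j, j < ν i ↔ j < ν' i := fun j => by rw [← mk_mem_shape, h, mk_mem_shape]
  exact le_antisymm (not_lt.1 fun h2 => lt_irrefl _ ((h1 _).1 h2))
    (not_lt.1 fun h2 => lt_irrefl _ ((h1 _).2 h2))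

lemma mem_interlacing {n : ℕ} {κ : Fin (n + 1) → ℕ} {ν : Fin n → ℕ} :
    ν ∈ interlacing κ ↔ ∀ i, κ i.succ ≤ ν i ∧ ν i ≤ κ i.castSucc := by
  simp [interlacing]

lemma shape_subset_of_mem_interlacing {n : ℕ} {κ : Fin (n + 1) → ℕ} {ν : Fin n → ℕ}
    (h : ν ∈ interlacing κ) : shape ν ⊆ shape κ := by
  intro c hc
  obtain ⟨h1, h2⟩ := mem_shape.1 hc
  exact mem_shape.2 ⟨by omega, h2.trans_le (mem_interlacing.1 h _).2⟩

lemma isHorizontalStripCompl_shape {n : ℕ} {κ : Fin (n + 1) → ℕ} {ν : Fin n → ℕ}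
    (h : ν ∈ interlacing κ) : IsHorizontalStripCompl (shape κ) (shape ν) := by
  intro c _ hc'
  refine ⟨fun hr => hc' ?_, fun hb => hc' ?_⟩
  · obtain ⟨h1, h2⟩ := mem_shape.1 hr
    exact mem_shape.2 ⟨h1, (Nat.lt_succ_self _).trans h2⟩
  · obtain ⟨h1, h2⟩ := mem_shape.1 hb
    exact mem_shape.2 ⟨Nat.lt_of_succ_lt_succ h1, h2.trans_le (mem_interlacing.1 h ⟨c.1, _⟩).1⟩

/-- Columns increase strictly, so a tableau with n possible entries has at most n rows; this is what
removes the last row of `κ`. -/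
lemma row_le_of_mem_tableau {n : ℕ} {ν : Finset (ℕ × ℕ)}
    (hν : ∀ i j, (i + 1, j) ∈ ν → (i, j) ∈ ν) {T : ν → Finset (Fin n)}
    (hT : IsSetValuedTableau ν T) (i j : ℕ) (h : (i, j) ∈ ν) (a : Fin n) (ha : a ∈ T ⟨(i, j), h⟩) :
    i ≤ a := by
  induction i generalizing a with
  | zero => exact Nat.zero_le _
  | succ i ih =>
    obtain ⟨b, hb⟩ := hT.1 ⟨(i, j), hν i j h⟩
    have h1 := ih (hν i j h) b hb
    have h2 : b < a := hT.2.2 ⟨(i, j), hν i j h⟩ ⟨(i + 1, j), h⟩ rfl b hb a ha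
    exact Nat.succ_le_of_lt (h1.trans_lt h2)

/-- The strip condition makes ν closed under moves to the left and upwards, and the existence of a
tableau bounds its number of rows. Thus every other ν in `tableauSum_succ` contributes zero. -/
lemma exists_shape_eq {n : ℕ} {κ : Fin (n + 1) → ℕ} (hκ : Antitone κ) {ν : Finset (ℕ × ℕ)}
    (hν : ν ⊆ shape κ) (hs : IsHorizontalStripCompl (shape κ) ν) (hne : (SVT n ν).Nonempty) :
    ∃ μ ∈ interlacing κ, shape μ = ν := by
  obtain ⟨T, hT⟩ := hne
  rw [mem_SVT] at hT
  have hcol : ∀ i j, (i + 1, j) ∈ ν → (i, j) ∈ ν := by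
    intro i j h
    by_contra hn
    obtain ⟨h1, h2⟩ := mem_shape.1 (hν h)
    exact (hs (i, j) (mem_shape.2 ⟨Nat.lt_of_succ_lt h1,
      lt_of_lt_of_le h2 (hκ (Fin.mk_le_mk.2 (Nat.le_succ i)))⟩) hn).2 (hν h)
  have hrow : ∀ i j, (i, j + 1) ∈ ν → (i, j) ∈ ν := by
    intro i j h
    by_contra hn
    obtain ⟨h1, h2⟩ := mem_shape.1 (hν h)
    exact (hs (i, j) (mem_shape.2 ⟨h1, Nat.lt_of_succ_lt h2⟩) hn).1 h
  have hrow' : ∀ i j j', j ≤ j' → (i, j') ∈ ν → (i, j) ∈ ν := by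
    intro i j j' hj
    induction j', hj using Nat.le_induction with
    | base => exact id
    | succ j' _ ih => exact fun h => ih (hrow _ _ h)
  have hlt : ∀ c ∈ ν, c.1 < n := by
    intro c hc
    obtain ⟨a, ha⟩ := hT.1 ⟨c, hc⟩
    exact (row_le_of_mem_tableau hcol hT c.1 c.2 hc a ha).trans_lt a.2
  have hex : ∀ i : Fin n, ∃ j, ((i : ℕ), j) ∉ ν := fun i => ⟨κ i.castSucc, fun h =>
    lt_irrefl _ (mk_mem_shape (i := i.castSucc).1 (hν h))⟩
  -- The length of row i is its first missing column.
  refine ⟨fun i => Nat.find (hex i), ?_, ?_⟩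
  · rw [mem_interlacing]
    intro i
    refine ⟨?_, Nat.find_min' (hex i) fun h => lt_irrefl _ (mk_mem_shape (i := i.castSucc).1 (hν h))⟩
    by_contra hlt
    rw [not_le] at hlt
    exact (hs _ (mk_mem_shape (i := i.castSucc).2 (hlt.trans_le (hκ (Fin.castSucc_le_succ i))))
      (Nat.find_spec (hex i))).2 (mk_mem_shape (i := i.succ).2 hlt)
  · ext ⟨i, j⟩
    rw [mem_shape]
    constructor
    · rintro ⟨h1, h2⟩
      exact not_not.1 (Nat.find_min (hex ⟨i, h1⟩) h2)
    · intro h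
      refine ⟨hlt _ h, ?_⟩
      by_contra h'
      rw [not_lt] at h'
      exact Nat.find_spec (hex ⟨i, hlt _ h⟩) (hrow' _ _ _ h' h)

lemma prod_shape_sdiff {n : ℕ} {κ : Fin (n + 1) → ℕ} {ν : Fin n → ℕ} (f : ℕ × ℕ → K) :
    ∏ c ∈ shape κ \ shape ν, f c =
      (∏ i : Fin n, ∏ j ∈ Ico (ν i) (κ i.castSucc), f ((i : ℕ), j)) *
        ∏ j ∈ range (κ (Fin.last n)), f (n, j) := by
  -- Padding ν by a zero part treats the last row of κ, which is removed completely, like the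
  -- others.
  have h : shape κ \ shape ν = (univ : Finset (Fin (n + 1))).biUnion fun i =>
      (Ico ((Fin.snoc ν 0 : Fin (n + 1) → ℕ) i) (κ i)).image fun j => ((i : ℕ), j) := by
    ext ⟨i, j⟩
    simp only [mem_sdiff, mem_shape, mem_biUnion, mem_univ, true_and, mem_image, mem_Ico,
      Prod.mk.injEq]
    constructor
    · rintro ⟨⟨h1, h2⟩, h3⟩
      refine ⟨⟨i, h1⟩, j, ⟨?_, h2⟩, rfl, rfl⟩
      by_cases hi : i < n
      · have : (⟨i, h1⟩ : Fin (n + 1)) = Fin.castSucc ⟨i, hi⟩ := rfl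
        rw [this, Fin.snoc_castSucc]
        exact not_lt.1 fun h => h3 ⟨hi, h⟩
      · have : (⟨i, h1⟩ : Fin (n + 1)) = Fin.last n := Fin.ext (by simp; omega)
        rw [this, Fin.snoc_last]
        exact Nat.zero_le _
    · rintro ⟨i, j, ⟨h1, h2⟩, rfl, rfl⟩
      refine ⟨⟨i.2, h2⟩, ?_⟩
      rintro ⟨h3, h4⟩
      have : i = Fin.castSucc ⟨i, h3⟩ := rfl
      rw [this, Fin.snoc_castSucc] at h1
      omega
  rw [h, prod_biUnion, Fin.prod_univ_castSucc]
  · congr 1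
    · refine prod_congr rfl fun i _ => ?_
      rw [prod_image (by intro _ _ _ _ h; exact (Prod.ext_iff.1 h).2), Fin.snoc_castSucc]
      rfl
    · rw [prod_image (by intro _ _ _ _ h; exact (Prod.ext_iff.1 h).2), Fin.snoc_last, range_eq_Ico]
      rfl
  · intro i _ i' _ hne
    simp only [Function.onFun, disjoint_left, mem_image, not_exists, not_and]
    rintro c ⟨j, _, rfl⟩ j' _ h
    exact hne (Fin.ext (Prod.ext_iff.1 h).1.symm)

/-- Only the last box of a row can be free, and it is so exactly when κ has no box below it. Then `ν
i > κ i.succ`, so `ν i - 1` is a genuine predecessor. -/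
lemma prod_freeCorners_shape {n : ℕ} {κ : Fin (n + 1) → ℕ} {ν : Fin n → ℕ}
    (h : ν ∈ interlacing κ) (f : ℕ × ℕ → K) :
    ∏ c ∈ freeCorners (shape κ) (shape ν), f c =
      ∏ i : Fin n, if ν i = κ i.succ then 1 else f ((i : ℕ), ν i - 1) := by
  rw [mem_interlacing] at h
  have e : freeCorners (shape κ) (shape ν) =
      ((univ : Finset (Fin n)).filter fun i => ν i ≠ κ i.succ).image
        fun i : Fin n => ((i : ℕ), ν i - 1) := by
    ext ⟨i, j⟩
    simp only [freeCorners, mem_filter, mem_image, mem_univ, true_and, Prod.mk.injEq]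
    constructor
    · rintro ⟨h1, h2, h3⟩
      obtain ⟨hi, h1⟩ := mem_shape.1 h1
      have h2 : ¬ j + 1 < ν ⟨i, hi⟩ := fun h' => h2 (mem_shape.2 ⟨hi, h'⟩)
      have h3 : ¬ j < κ (Fin.succ ⟨i, hi⟩) := fun h' =>
        h3 (mem_shape.2 ⟨Nat.succ_lt_succ hi, h'⟩)
      exact ⟨⟨i, hi⟩, by simp only at h1; omega, rfl, by simp only at h1; omega⟩
    · rintro ⟨i, hne, rfl, rfl⟩
      have hi := (h i).1
      refine ⟨mk_mem_shape.2 (by omega), fun h' => ?_, fun h' => ?_⟩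
      · have := mk_mem_shape.1 h'
        omega
      · have := (mk_mem_shape (i := i.succ)).1 h'
        omega
  rw [e, prod_image (by intro _ _ _ _ h; exact Fin.ext (Prod.ext_iff.1 h).1), prod_filter]
  exact prod_congr rfl fun i _ => by by_cases h : ν i = κ i.succ <;> simp [h]

/-- The largest entry in box (i, j) carries the parameter of site j + rev i + 1: for a removed box
this is a site crossed by the empty auxiliary line, for the corner j = ν i − 1 the site where the
particle is dropped. So the branching coefficients are those of C. -/
theorem groth_shape_succ (β : K) {n : ℕ} {κ : Fin (n + 1) → ℕ} (hκ : Antitone κ)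
    (x : Fin (n + 1) → K) (t : ℤ → K) :
    groth β (shape κ) x t = ∑ ν ∈ interlacing κ,
      rowWeight β (fun s => oplus β (x (Fin.last n)) (t (s + 1))) κ ν *
        groth β (shape ν) (fun i => x i.castSucc) t := by
  rw [groth_eq_tableauSum, tableauSum_succ]
  refine (sum_of_injOn shape shape_injective.injOn ?_ ?_ ?_).symm
  · intro ν hν
    rw [mem_coe] at hν
    rw [mem_coe, mem_filter, mem_powerset]
    exact ⟨shape_subset_of_mem_interlacing hν, isHorizontalStripCompl_shape hν⟩
  · intro ν hν hν'
    rw [mem_filter, mem_powerset] at hν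
    have : SVT n ν = ∅ := by
      by_contra hne
      obtain ⟨μ, h1, h2⟩ := exists_shape_eq hκ hν.1 hν.2 (nonempty_iff_ne_empty.2 hne)
      exact hν' ⟨μ, h1, h2⟩
    rw [tableauSum, this, sum_empty, mul_zero]
  · intro ν hν
    rw [groth_eq_tableauSum, prod_shape_sdiff, prod_freeCorners_shape hν, rowWeight,
      prod_mul_distrib]
    refine congrArg₂ (· * ·) ?_ rfl
    rw [mul_assoc, mul_comm]
    refine congrArg₂ (· * ·) ?_ ?_
    · refine congrArg₂ (· * ·) ?_ ?_
      · refine prod_congr rfl fun i _ => prod_congr rfl fun j _ => ?_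
        congr 2
        rw [Fin.val_rev, Fin.val_last]
        have := i.2
        push_cast [Nat.cast_sub (show (i : ℕ) + 1 ≤ n by omega)]
        ring
      · refine prod_congr rfl fun j _ => ?_
        congr 2
        rw [Fin.val_last]
        ring
    · refine prod_congr rfl fun i _ => if_ctx_congr Iff.rfl (fun _ => rfl) fun h => ?_
      congr 4
      have h1 := (mem_interlacing.1 hν i).1
      have := i.2
      rw [Fin.val_rev, Fin.val_last]
      push_cast [Nat.cast_sub (show (i : ℕ) + 1 ≤ n by omega),
        Nat.cast_sub (show 1 ≤ ν i by omega)]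
      ring

end ShapeBranching

/-! ### Matrix elements of products of C -/

section MatrixElements

variable {K : Type*} [Field K]

/-- The basis vector of a partition. -/
def state {n : ℕ} (N : ℕ) (ν : Fin n → ℕ) : Fin N → Fin 2 := fun j => spins ν j

lemma oplus_negParams {β : K} {t : ℤ → K} {j : ℤ} (h : 1 + β * t j ≠ 0) (x : K) :
    oplus β x (negParams β t j) = ominus β x (t j) := by
  have e : (0 - t j) / (1 + β * t j) * (1 + β * t j) = 0 - t j := div_mul_cancel₀ _ h
  rw [oplus, negParams, ominus, ominus, eq_div_iff h]
  linear_combination (1 + β * x) * e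

lemma opC_state {β : K} {N : ℕ} {t : ℤ → K} (ht : ∀ s < N, 1 + β * t ((s : ℕ) + 1) ≠ 0) (x : K)
    {n : ℕ} {κ : Fin (n + 1) → ℕ} (hκ : Antitone κ) (hN : κ 0 + n < N) (b' : Fin N → Fin 2) :
    opC β N t x b' (state N κ) = ∑ ν ∈ interlacing κ, if b' = state N ν then
      rowWeight β (fun s => oplus β x (negParams β t (s + 1))) κ ν else 0 := by
  rw [opC, monodromy_apply]
  have h1 := rowMatrix_spins_one_zero β (fun s => oplus β x (negParams β t (s + 1))) κ hκ hN
    (extendSpins b')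
  have h2 : ∀ ν : Fin n → ℕ, (∀ s < N, extendSpins b' s = spins ν s) ↔ b' = state N ν := by
    intro ν
    constructor
    · intro h
      funext j
      rw [← extendSpins_apply b' j, h j j.2, state]
    · rintro rfl s hs
      rw [extendSpins_of_lt _ hs, state]
  simp_rw [h2] at h1
  rw [← h1]
  refine congrFun (congrFun (rowMatrix_congr (fun s hs => ?_) (fun _ _ => rfl)
    fun s hs => ?_) 1) 0
  · exact (oplus_negParams (ht s hs) x).symm
  · rw [extendSpins_of_lt _ hs, state]

lemma antitone_of_mem_interlacing {n : ℕ} {κ : Fin (n + 1) → ℕ} (hκ : Antitone κ)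
    {ν : Fin n → ℕ} (h : ν ∈ interlacing κ) : Antitone ν := by
  rw [mem_interlacing] at h
  intro i j hij
  rcases hij.eq_or_lt with rfl | hij
  · exact le_rfl
  · exact (h j).2.trans ((hκ (Fin.succ_le_castSucc_iff.2 hij)).trans (h i).1)

lemma groth_empty (β : K) {n : ℕ} (x : Fin n → K) (t : ℤ → K) : groth β ∅ x t = 1 := by
  have h : SVT n ∅ = univ := filter_true_of_mem fun T _ =>
    ⟨fun c => absurd c.2 (notMem_empty _), fun c => absurd c.2 (notMem_empty _),
      fun c => absurd c.2 (notMem_empty _)⟩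
  simp [groth, h]

/-- The factor with the last variable acts first on the state, and that variable belongs to the
largest entry, so both sides obey the same recursion. -/
theorem prod_opC_state {β : K} {N : ℕ} {t : ℤ → K} (ht : ∀ s < N, 1 + β * t ((s : ℕ) + 1) ≠ 0)
    {n : ℕ} (x : Fin n → K) {κ : Fin n → ℕ} (hκ : Antitone κ) (hN : ∀ i, κ i + n ≤ N) :
    (List.ofFn fun i => opC β N t (x i)).prod (fun _ => 0) (state N κ) =
      groth β (shape κ) x (negParams β t) := by
  induction n with
  | zero =>
    have h1 : shape κ = ∅ := by simp [shape]
    have h2 : state N κ = fun _ => 0 := by funext j; simp [state, spins]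
    rw [h1, h2, groth_empty, List.ofFn_zero, List.prod_nil, Matrix.one_apply_eq]
  | succ n ih =>
    have hN0 := hN 0
    rw [List.ofFn_succ', List.concat_eq_append, List.prod_append, List.prod_singleton,
      Matrix.mul_apply, groth_shape_succ β hκ]
    simp_rw [opC_state ht _ hκ (by omega), mul_sum, mul_ite, mul_zero]
    rw [sum_comm]
    refine sum_congr rfl fun ν hν => ?_
    rw [sum_ite_eq' univ (state N ν), if_pos (mem_univ _), mul_comm,
      ih _ (antitone_of_mem_interlacing hκ hν)]
    intro i
    have h1 := (mem_interlacing.1 hν i).2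
    have h2 := hN i.castSucc
    omega

lemma vertex_conservation {β u : K} {c d a a' : Fin 2} (h : vertex β u c d a a' ≠ 0) :
    (a : ℕ) + c = a' + d := by
  revert h
  fin_cases a <;> fin_cases a' <;> fin_cases c <;> fin_cases d <;> simp [vertex]

lemma rowMatrix_conservation {β : K} {u : ℕ → K} {b' b : ℕ → Fin 2} {m : ℕ} {a c : Fin 2}
    (h : rowMatrix β u b' b m a c ≠ 0) :
    (a : ℕ) + ∑ s ∈ range m, (b' s : ℕ) = c + ∑ s ∈ range m, (b s : ℕ) := by
  induction m generalizing a with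
  | zero =>
    rw [rowMatrix, Matrix.one_apply] at h
    have : a = c := by by_contra h'; simp [h'] at h
    simp [this]
  | succ m ih =>
    rw [rowMatrix, Matrix.mul_apply] at h
    obtain ⟨d, _, hd⟩ := exists_ne_zero_of_sum_ne_zero h
    have h1 := vertex_conservation (left_ne_zero_of_mul hd)
    have h2 := ih (right_ne_zero_of_mul hd)
    rw [sum_range_succ, sum_range_succ]
    omega

/-- The number of 1-letters. -/
def particleNumber {N : ℕ} (b : Fin N → Fin 2) : ℕ := ∑ j, (b j : ℕ)

lemma sum_extendSpins {N : ℕ} (b : Fin N → Fin 2) :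
    ∑ s ∈ range N, (extendSpins b s : ℕ) = particleNumber b := by
  rw [sum_range, particleNumber]
  simp only [extendSpins_apply]

lemma opC_conservation {β : K} {N : ℕ} {t : ℤ → K} {x : K} {b' b : Fin N → Fin 2}
    (h : opC β N t x b' b ≠ 0) : particleNumber b = particleNumber b' + 1 := by
  rw [opC, monodromy_apply] at h
  have := rowMatrix_conservation h
  rw [sum_extendSpins, sum_extendSpins] at this
  simp only [Fin.val_one, Fin.val_zero] at this
  omega

/-- Each C removes one particle. This restricts the intermediate strings in `eForm` to those with n
particles, i.e. to partitions in the box. -/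
lemma prod_opC_conservation {β : K} {N : ℕ} {t : ℤ → K} {n : ℕ} {x : Fin n → K}
    {b : Fin N → Fin 2} (h : (List.ofFn fun i => opC β N t (x i)).prod (fun _ => 0) b ≠ 0) :
    particleNumber b = n := by
  induction n generalizing b with
  | zero =>
    rw [List.ofFn_zero, List.prod_nil, Matrix.one_apply] at h
    have : (fun _ => 0) = b := by by_contra h'; simp [h'] at h
    simp [← this, particleNumber]
  | succ n ih =>
    rw [List.ofFn_succ', List.concat_eq_append, List.prod_append, List.prod_singleton,
      Matrix.mul_apply] at h
    obtain ⟨d, _, hd⟩ := exists_ne_zero_of_sum_ne_zero h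
    rw [opC_conservation (right_ne_zero_of_mul hd), ih (left_ne_zero_of_mul hd)]

end MatrixElements

/-! ### Reading the row backwards: from B to C -/

section Reversal

variable {K : Type*} [Field K]

lemma rowMatrix_succ_bottom (β : K) (u : ℕ → K) (b' b : ℕ → Fin 2) (m : ℕ) :
    rowMatrix β u b' b (m + 1) =
      rowMatrix β (fun s => u (s + 1)) (fun s => b' (s + 1)) (fun s => b (s + 1)) m *
        vertex β (u 0) (b' 0) (b 0) := by
  induction m with
  | zero => simp [rowMatrix]
  | succ m ih => rw [rowMatrix, ih, rowMatrix, mul_assoc]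

/-- Interchanging incoming and outgoing indices swaps the drop, of weight 1 + β(x ⊖ t), with the
lift, of weight 1. The prefactors repair this because (1 + βt)(1 + β(x ⊖ t)) = 1 + βx. -/
lemma vertex_transpose {β x t : K} (ht : 1 + β * t ≠ 0) (a a' c d : Fin 2) :
    (1 + β * x) ^ (a : ℕ) * (1 + β * t) ^ (c : ℕ) * vertex β (ominus β x t) c d a a' =
      (1 + β * x) ^ (a' : ℕ) * (1 + β * t) ^ (d : ℕ) * vertex β (ominus β x t) d c a' a := by
  have h : (1 + β * t) * (1 + β * ominus β x t) = 1 + β * x := by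
    rw [ominus]; field_simp; ring
  fin_cases a <;> fin_cases a' <;> fin_cases c <;> fin_cases d <;> simp [vertex, h]

/-- Transposing the product reverses the order of the sites. The factors in x at inner auxiliary
edges cancel, leaving those at the two ends. -/
lemma rowMatrix_transpose {β x : K} {τ : ℕ → K} {m : ℕ} (ht : ∀ s < m, 1 + β * τ s ≠ 0)
    (b' b : ℕ → Fin 2) (a c : Fin 2) :
    (1 + β * x) ^ (a : ℕ) * (∏ s ∈ range m, (1 + β * τ s) ^ (b' s : ℕ)) *
        rowMatrix β (fun s => ominus β x (τ s)) b' b m a c =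
      (1 + β * x) ^ (c : ℕ) * (∏ s ∈ range m, (1 + β * τ s) ^ (b s : ℕ)) *
        rowMatrix β (fun s => ominus β x (τ (m - 1 - s))) (fun s => b (m - 1 - s))
          (fun s => b' (m - 1 - s)) m c a := by
  induction m generalizing a with
  | zero =>
    simp only [rowMatrix, range_zero, prod_empty, Matrix.one_apply]
    by_cases h : a = c
    · simp [h]
    · simp [h, Ne.symm h]
  | succ m ih =>
    have hsub : ∀ s, m + 1 - 1 - (s + 1) = m - 1 - s := fun s => by omega
    have hbot := rowMatrix_succ_bottom β (fun s => ominus β x (τ (m + 1 - 1 - s)))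
      (fun s => b (m + 1 - 1 - s)) (fun s => b' (m + 1 - 1 - s)) m
    simp only [hsub] at hbot
    rw [hbot, rowMatrix, Matrix.mul_apply, Matrix.mul_apply, mul_sum, mul_sum]
    refine sum_congr rfl fun d _ => ?_
    have h1 := vertex_transpose (x := x) (ht m (by omega)) a d (b' m) (b m)
    have h2 := ih (fun s hs => ht s (by omega)) d
    simp only [Nat.add_sub_cancel, Nat.sub_zero, prod_range_succ]
    linear_combination (∏ s ∈ range m, (1 + β * τ s) ^ (b' s : ℕ)) *
      rowMatrix β (fun s => ominus β x (τ s)) b' b m d c * h1 +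
      (1 + β * τ m) ^ (b m : ℕ) * vertex β (ominus β x (τ m)) (b m) (b' m) d a * h2

/-- The weight `∏_j (1 + β t_j)` over the positions `j` of the 1-letters. -/
def stateWeight (β : K) {N : ℕ} (t : ℤ → K) (b : Fin N → Fin 2) : K :=
  ∏ j : Fin N, (1 + β * t ((j : ℕ) + 1)) ^ (b j : ℕ)

lemma opB_eq_opC_rev {β : K} {N : ℕ} {t : ℤ → K} (ht : ∀ s < N, 1 + β * t ((s : ℕ) + 1) ≠ 0)
    (y : K) (b' b : Fin N → Fin 2) :
    stateWeight β t b' * opB β N t y b' b =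
      (1 + β * y) * stateWeight β t b *
        opC β N (revParams N t) y (fun j => b j.rev) (fun j => b' j.rev) := by
  have h := rowMatrix_transpose (x := y) (τ := fun s => t ((s : ℕ) + 1)) ht
    (extendSpins b') (extendSpins b) 0 1
  have hw : ∀ b : Fin N → Fin 2, ∏ s ∈ range N, (1 + β * t ((s : ℕ) + 1)) ^ (extendSpins b s : ℕ) =
      stateWeight β t b := fun b => by
    rw [prod_range, stateWeight]
    simp only [extendSpins_apply]
  rw [hw, hw] at h
  simp only [Fin.val_zero, pow_zero, Fin.val_one, pow_one, one_mul] at h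
  rw [opB, opC, monodromy_apply, monodromy_apply, h]
  have hrev : ∀ (b : Fin N → Fin 2), ∀ s < N,
      extendSpins b (N - 1 - s) = extendSpins (fun j => b j.rev) s := by
    intro b s hs
    rw [extendSpins_of_lt _ hs, extendSpins_of_lt _ (by omega)]
    congr 1
    ext
    simp only [Fin.val_rev]
    omega
  congr 1
  refine congrFun (congrFun (rowMatrix_congr (fun s hs => ?_) (hrev b) (hrev b')) 1) 0
  rw [revParams]
  congr 2
  rw [Nat.sub_sub, Nat.cast_sub (by omega)]
  push_cast
  ring

/-- Transposition reverses the order of the operators too, which undoes the reversed product; the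
weights of the intermediate strings cancel. -/
theorem prod_opB_eq_prod_opC_rev {β : K} {N : ℕ} {t : ℤ → K}
    (ht : ∀ s < N, 1 + β * t ((s : ℕ) + 1) ≠ 0) {n : ℕ} (y : Fin n → K) (b' b : Fin N → Fin 2) :
    stateWeight β t b' * (List.ofFn fun i => opB β N t (y i)).reverse.prod b' b =
      bigPi β y * stateWeight β t b *
        (List.ofFn fun i => opC β N (revParams N t) (y i)).prod
          (fun j => b j.rev) (fun j => b' j.rev) := by
  induction n generalizing b' with
  | zero =>
    have h : ((fun j : Fin N => b j.rev) = fun j => b' j.rev) ↔ b' = b := by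
      constructor
      · intro h
        funext j
        simpa using (congrFun h j.rev).symm
      · rintro rfl; rfl
    simp only [List.ofFn_zero, List.reverse_nil, List.prod_nil, bigPi, univ_eq_empty, prod_empty,
      one_mul, Matrix.one_apply, h]
    split_ifs with h' <;> simp [h']
  | succ n ih =>
    rw [List.ofFn_succ', List.concat_eq_append, List.reverse_append, List.reverse_singleton,
      List.singleton_append, List.prod_cons, List.ofFn_succ', List.concat_eq_append,
      List.prod_append, List.prod_singleton, Matrix.mul_apply, Matrix.mul_apply, mul_sum, mul_sum]
    let e : (Fin N → Fin 2) ≃ (Fin N → Fin 2) := Equiv.arrowCongr Fin.revPerm (Equiv.refl _)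
    have he : ∀ b, e b = fun j => b j.rev := fun b => rfl
    conv_rhs => rw [← e.sum_comp]
    refine sum_congr rfl fun d _ => ?_
    have h1 := opB_eq_opC_rev ht (y (Fin.last n)) b' d
    have h2 := ih (fun i => y i.castSucc) d
    rw [he, bigPi, Fin.prod_univ_castSucc]
    rw [bigPi] at h2
    linear_combination (List.ofFn fun i : Fin n => opB β N t (y i.castSucc)).reverse.prod d b * h1 +
      (1 + β * y (Fin.last n)) *
        opC β N (revParams N t) (y (Fin.last n)) (fun j => d j.rev) (fun j => b' j.rev) * h2

end Reversal

/-! ### Partitions in the box as binary strings; the expansion of e -/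

section BoxedStates

variable {n k : ℕ}

/-- The parts of a partition, as natural numbers. -/
def parts (lam : BoxedPartition n k) : Fin n → ℕ := fun i => lam.1 i

lemma antitone_parts (lam : BoxedPartition n k) : Antitone (parts lam) := fun i j h => lam.2 i j h

lemma parts_le (lam : BoxedPartition n k) (i : Fin n) : parts lam i ≤ k := Fin.is_le _

lemma letterPos_eq (lam : BoxedPartition n k) (i : Fin n) :
    letterPos lam i = ((parts lam i.rev + i : ℕ) : ℤ) + 1 := by
  simp [letterPos, parts]

lemma strictMono_letterPos (lam : BoxedPartition n k) : StrictMono (letterPos lam) := by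
  intro i j h
  have h1 := antitone_parts lam (Fin.rev_le_rev.2 h.le)
  have h2 : (i : ℕ) < j := h
  rw [letterPos_eq, letterPos_eq]
  omega

lemma spins_eq_one_iff {n : ℕ} {ν : Fin n → ℕ} {s : ℕ} :
    spins ν s = 1 ↔ ∃ i, s = ν i + (i.rev : ℕ) := by
  unfold spins
  split_ifs with h
  · exact iff_of_true rfl h
  · exact iff_of_false zero_ne_one h

lemma state_eq_one_iff (lam : BoxedPartition n k) {N : ℕ} (j : Fin N) :
    state N (parts lam) j = 1 ↔ ∃ i, ((j : ℕ) : ℤ) + 1 = letterPos lam i := by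
  rw [state, spins_eq_one_iff, Fin.rev_surjective.exists]
  refine exists_congr fun i => ?_
  rw [letterPos_eq, Fin.rev_rev]
  omega

lemma letterPos_mem (lam : BoxedPartition n k) (i : Fin n) :
    ∃ j : Fin (n + k), ((j : ℕ) : ℤ) + 1 = letterPos lam i := by
  have h1 := parts_le lam i.rev
  have h2 := i.2
  exact ⟨⟨parts lam i.rev + i, by omega⟩, (letterPos_eq lam i).symm⟩

/-- Reflection sends the site ν i + rev i to (k − ν i) + i. -/
lemma state_rev (lam : BoxedPartition n k) :
    (fun j : Fin (n + k) => state (n + k) (parts lam) j.rev) =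
      state (n + k) (parts (vee lam)) := by
  funext j
  have h1 : ∀ a b : Fin 2, (a = 1 ↔ b = 1) → a = b := by decide
  refine h1 _ _ ?_
  rw [state, state, spins_eq_one_iff, spins_eq_one_iff]
  constructor
  · rintro ⟨i, hi⟩
    refine ⟨i.rev, ?_⟩
    have := parts_le lam i
    have h2 : parts (vee lam) i.rev = k - parts lam i := by
      simp only [parts, vee, Fin.rev_rev, Fin.val_rev]; omega
    have hi' := i.rev.2
    rw [h2, Fin.rev_rev]
    simp only [Fin.val_rev] at hi hi' ⊢
    omega
  · rintro ⟨i, hi⟩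
    refine ⟨i.rev, ?_⟩
    have := parts_le lam i.rev
    have h2 : parts (vee lam) i = k - parts lam i.rev := by
      simp only [parts, vee, Fin.val_rev]; omega
    have hi' := i.2
    rw [h2] at hi
    rw [Fin.rev_rev]
    simp only [Fin.val_rev] at hi ⊢ this
    omega

lemma state_parts_injective :
    Function.Injective fun lam : BoxedPartition n k => state (n + k) (parts lam) := by
  intro lam lam' h
  have hsub : ∀ lam lam' : BoxedPartition n k,
      state (n + k) (parts lam) = state (n + k) (parts lam') →
      Set.range (letterPos lam) ⊆ Set.range (letterPos lam') := by
    rintro lam lam' h _ ⟨i, rfl⟩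
    obtain ⟨j, hj⟩ := letterPos_mem lam i
    have := (state_eq_one_iff lam j).2 ⟨i, hj⟩
    rw [h, state_eq_one_iff] at this
    obtain ⟨i', hi'⟩ := this
    exact ⟨i', by rw [← hi', hj]⟩
  have hrange := ((strictMono_letterPos lam).range_inj (strictMono_letterPos lam')).1
    ((hsub _ _ h).antisymm (hsub _ _ h.symm))
  ext i
  have := congrFun hrange i.rev
  rw [letterPos_eq, letterPos_eq, Fin.rev_rev] at this
  simp only [parts] at this
  omega

/-- List the occupied sites increasingly as e 0 < ⋯ < e (n − 1). The differences e i − i increase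
weakly from at least 0 to at most k, and they are the parts read from the last. -/
lemma exists_state_eq {b : Fin (n + k) → Fin 2} (h : particleNumber b = n) :
    ∃ lam : BoxedPartition n k, state (n + k) (parts lam) = b := by
  have h01 : ∀ a : Fin 2, (a : ℕ) = if a = 1 then 1 else 0 := by decide
  have hcard : #(univ.filter fun j => b j = 1) = n := by
    refine Eq.trans ?_ h
    rw [card_filter, particleNumber]
    exact sum_congr rfl fun j _ => (h01 _).symm
  let e := (univ.filter fun j => b j = 1).orderEmbOfFin hcard
  have hstep : ∀ i j : Fin n, i ≤ j → (e i : ℕ) + (j - i) ≤ e j := by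
    intro i ⟨j, hj⟩ hij
    have hij' : (i : ℕ) ≤ j := hij
    induction j, hij' using Nat.le_induction with
    | base => simp
    | succ j hij' ih =>
      have h1 := ih (by omega) hij'
      have h2 : (e ⟨j, by omega⟩ : ℕ) < e ⟨j + 1, hj⟩ :=
        e.strictMono (Fin.mk_lt_mk.2 (Nat.lt_succ_self j))
      simp only at h1 ⊢
      omega
  have hlow : ∀ i : Fin n, (i : ℕ) ≤ e i := by
    intro i
    have := hstep ⟨0, i.pos⟩ i (Fin.mk_le_of_le_val (Nat.zero_le _))
    simp only at this
    omega
  have hhigh : ∀ i : Fin n, (e i : ℕ) ≤ i + k := by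
    intro i
    have hi := i.2
    have h1 := hstep i ⟨n - 1, by omega⟩ (Fin.mk_le_mk.2 (by omega))
    have h2 := (e ⟨n - 1, by omega⟩).2
    simp only at h1
    omega
  refine ⟨⟨fun i => ⟨(e i.rev : ℕ) - (i.rev : ℕ), by have := hhigh i.rev; omega⟩, ?_⟩, ?_⟩
  · intro i j hij
    have h1 := hstep _ _ (Fin.rev_le_rev.2 hij)
    have h2 := hlow j.rev
    have h3 : (j.rev : ℕ) ≤ i.rev := Fin.rev_le_rev.2 hij
    exact Fin.mk_le_mk.2 (by omega)
  · funext j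
    have h1 : ∀ a b : Fin 2, (a = 1 ↔ b = 1) → a = b := by decide
    refine h1 _ _ ?_
    rw [state, spins_eq_one_iff]
    simp only [parts]
    have h2 : b j = 1 ↔ j ∈ Set.range e := by
      rw [range_orderEmbOfFin]; simp
    rw [h2, Set.mem_range, Fin.rev_surjective.exists]
    refine exists_congr fun i => ?_
    have := hlow i
    rw [Fin.rev_rev, Fin.ext_iff]
    omega

variable {K : Type*} [Field K]

lemma stateWeight_state (β : K) (t : ℤ → K) (lam : BoxedPartition n k) :
    stateWeight β t (state (n + k) (parts lam)) = bigPi β (tParams t lam) := by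
  choose f hf using letterPos_mem lam
  rw [stateWeight, bigPi]
  refine (prod_of_injOn f ?_ (fun _ _ => mem_coe.2 (mem_univ _)) ?_ ?_).symm
  · intro i _ i' _ h
    refine (strictMono_letterPos lam).injective ?_
    rw [← hf, ← hf, h]
  · intro j _ hj
    have h : state (n + k) (parts lam) j ≠ 1 := by
      rw [Ne, state_eq_one_iff]
      rintro ⟨i, hi⟩
      refine hj ⟨i, by simp, Fin.ext ?_⟩
      have := hf i
      omega
    have h0 : state (n + k) (parts lam) j = 0 := by omega
    simp [h0]
  · intro i _
    rw [(state_eq_one_iff lam (f i)).2 ⟨i, hf i⟩, hf, tParams]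
    simp

lemma diagram_eq_shape (lam : BoxedPartition n k) : diagram lam = shape (parts lam) := rfl

theorem eForm_eq_sum_groth {β : K} {t : ℤ → K}
    (ht : ∀ s < n + k, 1 + β * t ((s : ℕ) + 1) ≠ 0) (x y : Fin n → K) :
    eForm β (n + k) t x y = ∑ lam : BoxedPartition n k,
      bigPi β y / bigPi β (tParams t lam) *
        groth β (diagram (vee lam)) y (negParams β (revParams (n + k) t)) *
        groth β (diagram lam) x (negParams β t) := by
  have hrev : ∀ s < n + k, 1 + β * revParams (n + k) t ((s : ℕ) + 1) ≠ 0 := by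
    intro s hs
    have h := ht (n + k - 1 - s) (by omega)
    rwa [revParams, show ((n + k : ℕ) : ℤ) + 1 - ((s : ℤ) + 1) =
      ((n + k - 1 - s : ℕ) : ℤ) + 1 by omega]
  have hbox : ∀ (lam : BoxedPartition n k) i, parts lam i + n ≤ n + k := fun lam i => by
    have := parts_le lam i
    omega
  rw [eForm, Matrix.mul_apply]
  refine (sum_of_injOn (fun lam : BoxedPartition n k => state (n + k) (parts lam))
    state_parts_injective.injOn (fun _ _ => mem_coe.2 (mem_univ _)) ?_ ?_).symm
  · intro b _ hb
    by_contra h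
    obtain ⟨lam, hlam⟩ := exists_state_eq (prod_opC_conservation (left_ne_zero_of_mul h))
    exact hb ⟨lam, by simp, hlam⟩
  · intro lam _
    have hne : bigPi β (tParams t lam) ≠ 0 := by
      rw [bigPi, prod_ne_zero_iff]
      intro i _
      obtain ⟨j, hj⟩ := letterPos_mem lam i
      rw [tParams, ← hj]
      exact ht j j.2
    have h0 : stateWeight β t (fun _ : Fin (n + k) => 0) = 1 := by simp [stateWeight]
    -- The vacuum has weight 1, so only Π(y) and Π(t_λ) remain.
    have h := prod_opB_eq_prod_opC_rev ht y (state (n + k) (parts lam)) fun _ => 0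
    rw [state_rev, h0, mul_one, stateWeight_state,
      prod_opC_state hrev y (antitone_parts _) (hbox _)] at h
    rw [prod_opC_state ht x (antitone_parts _) (hbox _), diagram_eq_shape, diagram_eq_shape,
      div_mul_eq_mul_div, ← h]
    rw [mul_div_cancel_left₀ _ hne, mul_comm]

end BoxedStates

/-! ### Exchange of the parameters of neighbouring sites -/

section ColumnExchange

variable {K : Type*} [Field K]

/-- The matrix exchanging the parameters `t` and `s` of two neighbouring sites in terms of
`w = s ⊖ t`; the arguments are the outgoing and the incoming spins at both sites. -/
def exchangeWeight (β w : K) (o o' i i' : Fin 2) : K :=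
  ![![![![1, 0], ![0, 0]], ![![0, 1 + β * w], ![0, 0]]],
    ![![![0, w], ![1, 0]], ![![0, 0], ![0, 1]]]] o o' i i'

/-- A Yang–Baxter relation, checked entry by entry. Here v stands for x ⊖ s, so that v ⊕ w is x ⊖ t.
-/
lemma exchangeWeight_vertex (β v w : K) (o o' i i' a c : Fin 2) :
    ∑ p, ∑ q, exchangeWeight β w o o' p q *
        (vertex β v q i' * vertex β (v + w + β * v * w) p i) a c =
      ∑ p, ∑ q, exchangeWeight β w p q i i' *
        (vertex β (v + w + β * v * w) o' q * vertex β v o p) a c := by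
  fin_cases o <;> fin_cases o' <;> fin_cases i <;> fin_cases i' <;>
    fin_cases a <;> fin_cases c <;>
    simp [exchangeWeight, vertex, Fin.sum_univ_two, Matrix.mul_apply] <;> ring

lemma ominus_trans {β x s t : K} (ht : 1 + β * t ≠ 0) (hs : 1 + β * s ≠ 0) :
    ominus β x t = ominus β x s + ominus β s t + β * ominus β x s * ominus β s t := by
  have e1 : ominus β x s * (1 + β * s) = x - s := div_mul_cancel₀ _ hs
  have e2 : ominus β s t * (1 + β * t) = s - t := div_mul_cancel₀ _ ht
  have e3 : ominus β x t * (1 + β * t) = x - t := div_mul_cancel₀ _ ht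
  apply mul_right_cancel₀ ht
  linear_combination e3 - e1 - (1 + β * ominus β x s) * e2

/-- The spins `b` with the ones at the sites `j` and `j + 1` replaced. -/
def setPair (b : ℕ → Fin 2) (j : ℕ) (p q : Fin 2) : ℕ → Fin 2 :=
  fun s => if s = j then p else if s = j + 1 then q else b s

lemma setPair_of_ne {b : ℕ → Fin 2} {j s : ℕ} (p q : Fin 2) (h : s ≠ j) (h' : s ≠ j + 1) :
    setPair b j p q s = b s := by
  rw [setPair, if_neg h, if_neg h']

/-- The sites below and above the pair contribute the same factors on both sides, so the relation
for two vertices suffices. -/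
lemma rowMatrix_exchange {β w : K} {u u' : ℕ → K} {j : ℕ}
    (h0 : u j = u (j + 1) + w + β * u (j + 1) * w) (h1 : u' j = u (j + 1)) (h2 : u' (j + 1) = u j)
    (hu : ∀ s, s ≠ j → s ≠ j + 1 → u' s = u s) (b' b : ℕ → Fin 2) {m : ℕ} (hm : j + 2 ≤ m)
    (a c : Fin 2) :
    ∑ p, ∑ q, exchangeWeight β w (b' j) (b' (j + 1)) p q *
        rowMatrix β u (setPair b' j p q) b m a c =
      ∑ p, ∑ q, exchangeWeight β w p q (b j) (b (j + 1)) *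
        rowMatrix β u' b' (setPair b j p q) m a c := by
  induction m, hm using Nat.le_induction generalizing a with
  | base =>
    have hne : j + 1 ≠ j := by omega
    have hL : ∀ p q, rowMatrix β u (setPair b' j p q) b j = rowMatrix β u b' b j := fun p q =>
      rowMatrix_congr (fun _ _ => rfl) (fun s hs => setPair_of_ne _ _ (by omega) (by omega))
        (fun _ _ => rfl)
    have hR : ∀ p q, rowMatrix β u' b' (setPair b j p q) j = rowMatrix β u b' b j := fun p q =>
      rowMatrix_congr (fun s hs => hu s (by omega) (by omega)) (fun _ _ => rfl)
        (fun s hs => setPair_of_ne _ _ (by omega) (by omega))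
    have e := exchangeWeight_vertex β (u (j + 1)) w (b' j) (b' (j + 1)) (b j) (b (j + 1))
    have e0 := e a 0
    have e1 := e a 1
    rw [← h0] at e0 e1
    simp only [rowMatrix, hL, hR, ← mul_assoc, h1, h2, setPair, if_true, if_neg hne]
    simp only [Matrix.mul_apply (M := _ * _), Fin.sum_univ_two] at e0 e1 ⊢
    linear_combination (rowMatrix β u b' b j 0 c) * e0 + (rowMatrix β u b' b j 1 c) * e1
  | succ m hm ih =>
    have i0 := ih 0
    have i1 := ih 1
    simp only [rowMatrix, hu m (by omega) (by omega),
      setPair_of_ne _ _ (show m ≠ j by omega) (show m ≠ j + 1 by omega)]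
    simp only [Matrix.mul_apply, Fin.sum_univ_two] at i0 i1 ⊢
    linear_combination (vertex β (u m) (b' m) (b m) a 0) * i0 +
      (vertex β (u m) (b' m) (b m) a 1) * i1

/-- The operator acting as the exchange matrix on the sites `j` and `j + 1`. -/
def exchangeOp {N : ℕ} (β w : K) (j : ℕ) : QuantumOp N K :=
  fun b' b => if ∀ l : Fin N, (l : ℕ) ≠ j → (l : ℕ) ≠ j + 1 → b' l = b l then
    exchangeWeight β w (extendSpins b' j) (extendSpins b' (j + 1)) (extendSpins b j)
      (extendSpins b (j + 1)) else 0

lemma extendSpins_setPair {N : ℕ} (b : Fin N → Fin 2) {j s : ℕ} (hj : j + 1 < N) (p q : Fin 2) :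
    extendSpins (fun l : Fin N => setPair (extendSpins b) j p q l) s =
      setPair (extendSpins b) j p q s := by
  by_cases hs : s < N
  · rw [extendSpins_of_lt _ hs]
  · rw [setPair_of_ne _ _ (by omega) (by omega)]
    simp [extendSpins, hs]

lemma sum_agreeing_off_pair {N : ℕ} (b : Fin N → Fin 2) {j : ℕ} (hj : j + 1 < N)
    (f : (Fin N → Fin 2) → K) :
    ∑ d, (if ∀ l : Fin N, (l : ℕ) ≠ j → (l : ℕ) ≠ j + 1 → b l = d l then f d else 0) =
      ∑ p, ∑ q, f fun l => setPair (extendSpins b) j p q l := by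
  rw [← sum_filter, ← sum_product']
  refine sum_nbij' (fun d => (d ⟨j, by omega⟩, d ⟨j + 1, hj⟩))
    (fun p => fun l : Fin N => setPair (extendSpins b) j p.1 p.2 l) ?_ ?_ ?_ ?_ ?_
  · intro d _; simp
  · rintro ⟨p, q⟩ _
    rw [mem_filter]
    refine ⟨mem_univ _, fun l h1 h2 => ?_⟩
    dsimp only
    rw [setPair_of_ne _ _ h1 h2, extendSpins_apply]
  · intro d hd
    rw [mem_filter] at hd
    funext l
    by_cases h1 : (l : ℕ) = j
    · subst h1; simp [setPair]
    · by_cases h2 : (l : ℕ) = j + 1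
      · have : l = ⟨j + 1, hj⟩ := Fin.ext h2
        subst this; simp [setPair]
      · rw [setPair_of_ne _ _ h1 h2, extendSpins_apply, hd.2 l h1 h2]
  · rintro ⟨p, q⟩ _
    simp [setPair]
  · intro d hd
    rw [mem_filter] at hd
    congr 1
    funext l
    by_cases h1 : (l : ℕ) = j
    · subst h1; simp [setPair]
    · by_cases h2 : (l : ℕ) = j + 1
      · have : l = ⟨j + 1, hj⟩ := Fin.ext h2
        subst this; simp [setPair]
      · rw [setPair_of_ne _ _ h1 h2, extendSpins_apply, hd.2 l h1 h2]

lemma exchangeOp_mul_monodromy {β : K} {N : ℕ} {t t' : ℤ → K} {j : ℕ} (hj : j + 1 < N)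
    (h0 : 1 + β * t (j + 1) ≠ 0) (h1 : 1 + β * t ((j + 1 : ℕ) + 1) ≠ 0)
    (ht0 : t' (j + 1) = t ((j + 1 : ℕ) + 1)) (ht1 : t' ((j + 1 : ℕ) + 1) = t (j + 1))
    (ht : ∀ s : ℕ, s ≠ j → s ≠ j + 1 → t' (s + 1) = t (s + 1)) (x : K) (a c : Fin 2) :
    SemiconjBy (exchangeOp β (ominus β (t ((j + 1 : ℕ) + 1)) (t (j + 1))) j)
      (monodromy β N t x a c) (monodromy β N t' x a c) := by
  set w := ominus β (t ((j + 1 : ℕ) + 1)) (t (j + 1)) with hw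
  funext b' b
  have hsymm : ∀ d : Fin N → Fin 2, (exchangeOp β w j : QuantumOp N K) d b =
      if ∀ l : Fin N, (l : ℕ) ≠ j → (l : ℕ) ≠ j + 1 → b l = d l then
        exchangeWeight β w (extendSpins d j) (extendSpins d (j + 1)) (extendSpins b j)
          (extendSpins b (j + 1)) else 0 := fun d => by
    rw [exchangeOp]
    refine if_congr ?_ rfl rfl
    exact forall_congr' fun l => imp_congr_right fun _ => imp_congr_right fun _ => eq_comm
  rw [Matrix.mul_apply, Matrix.mul_apply]
  simp_rw [hsymm, exchangeOp, ite_mul, mul_ite, zero_mul, mul_zero]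
  rw [sum_agreeing_off_pair b' hj, sum_agreeing_off_pair b hj]
  have key := rowMatrix_exchange (β := β) (w := w) (u := fun s => ominus β x (t (s + 1)))
    (u' := fun s => ominus β x (t' (s + 1))) (j := j) (ominus_trans h0 h1)
    (by simp only [ht0]) (by simp only [ht1]) (fun s hs hs' => by simp only [ht s hs hs'])
    (extendSpins b') (extendSpins b) (m := N) hj a c
  have hj' : j + 1 ≠ j := by omega
  have hp : ∀ (b : ℕ → Fin 2) (p q : Fin 2), setPair b j p q j = p := fun b p q => by
    simp [setPair]
  have hq : ∀ (b : ℕ → Fin 2) (p q : Fin 2), setPair b j p q (j + 1) = q := fun b p q => by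
    simp [setPair]
  simp only [monodromy_apply, extendSpins_setPair _ hj, hp, hq]
  have hext : ∀ (b : Fin N → Fin 2) p q,
      extendSpins (fun l : Fin N => setPair (extendSpins b) j p q l) =
        setPair (extendSpins b) j p q := fun b p q => funext fun s => extendSpins_setPair b hj p q
  simp only [hext]
  simpa only [mul_comm] using key

/-- The exchange operator fixes the vacuum as a row and as a column vector; with the intertwining
relation this replaces any appeal to invertibility. -/
lemma exchangeOp_apply_zero {N : ℕ} (β w : K) (j : ℕ) (b : Fin N → Fin 2) :
    (exchangeOp β w j : QuantumOp N K) b (fun _ => 0) = (1 : QuantumOp N K) b (fun _ => 0) ∧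
    (exchangeOp β w j : QuantumOp N K) (fun _ => 0) b = (1 : QuantumOp N K) (fun _ => 0) b := by
  have hz : ∀ b : Fin N → Fin 2, (∀ l : Fin N, (l : ℕ) ≠ j → (l : ℕ) ≠ j + 1 → b l = 0) →
      extendSpins b j = 0 → extendSpins b (j + 1) = 0 → b = fun _ => 0 := by
    intro b h h0 h1
    funext l
    by_cases h2 : (l : ℕ) = j
    · rw [← extendSpins_apply b l, h2, h0]
    · by_cases h3 : (l : ℕ) = j + 1
      · rw [← extendSpins_apply b l, h3, h1]
      · exact h l h2 h3
  have h0 : ∀ s, extendSpins (fun _ : Fin N => (0 : Fin 2)) s = 0 := fun s => by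
    simp [extendSpins]
  by_cases hb : b = fun _ => 0
  · subst hb
    simp [exchangeOp, h0, exchangeWeight]
  · have h2 : ∀ o o' : Fin 2, ¬ (o = 0 ∧ o' = 0) →
        exchangeWeight β w o o' 0 0 = 0 ∧ exchangeWeight β w 0 0 o o' = 0 := by
      intro o o' h
      fin_cases o <;> fin_cases o' <;> simp [exchangeWeight] at h ⊢
    rw [Matrix.one_apply_ne hb, Matrix.one_apply_ne (Ne.symm hb), exchangeOp, exchangeOp]
    constructor
    · split_ifs with h
      · rw [h0, h0]
        exact (h2 _ _ fun h' => hb (hz b h h'.1 h'.2)).1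
      · rfl
    · split_ifs with h
      · rw [h0, h0]
        exact (h2 _ _ fun h' => hb (hz b (fun l hl hl' => (h l hl hl').symm) h'.1 h'.2)).2
      · rfl

/-- The intertwining relation passes to products of C's and B's; taking its vacuum matrix element
removes the exchange operator from both sides. -/
theorem eForm_swap {β : K} {N : ℕ} {t t' : ℤ → K} {j : ℕ} (hj : j + 1 < N)
    (h0 : 1 + β * t (j + 1) ≠ 0) (h1 : 1 + β * t ((j + 1 : ℕ) + 1) ≠ 0)
    (ht0 : t' (j + 1) = t ((j + 1 : ℕ) + 1)) (ht1 : t' ((j + 1 : ℕ) + 1) = t (j + 1))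
    (ht : ∀ s : ℕ, s ≠ j → s ≠ j + 1 → t' (s + 1) = t (s + 1)) {n : ℕ} (x y : Fin n → K) :
    eForm β N t' x y = eForm β N t x y := by
  have hprod : ∀ (R : QuantumOp N K) {m : ℕ} (f g : Fin m → QuantumOp N K),
      (∀ i, SemiconjBy R (f i) (g i)) →
        SemiconjBy R (List.ofFn f).prod (List.ofFn g).prod ∧
        SemiconjBy R (List.ofFn f).reverse.prod (List.ofFn g).reverse.prod := by
    intro R m f g h
    induction m with
    | zero => simp
    | succ m ih =>
      have h' := ih (fun i => f i.succ) (fun i => g i.succ) fun i => h i.succ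
      simp only [List.ofFn_succ, List.prod_cons, List.reverse_cons, List.prod_append,
        List.prod_nil, mul_one]
      exact ⟨(h 0).mul_right h'.1, h'.2.mul_right (h 0)⟩
  have hR := fun x => exchangeOp_mul_monodromy hj h0 h1 ht0 ht1 ht x
  have hR0 := exchangeOp_apply_zero (N := N) β (ominus β (t ((j + 1 : ℕ) + 1)) (t (j + 1))) j
  set R : QuantumOp N K := exchangeOp β (ominus β (t ((j + 1 : ℕ) + 1)) (t (j + 1))) j
  have h := ((hprod R _ _ fun i => hR (x i) 1 0).1.mul_right
    (hprod R _ _ fun i => hR (y i) 0 1).2).eq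
  have h00 := congrFun (congrFun h fun _ => 0) fun _ => 0
  rw [Matrix.mul_apply, Matrix.mul_apply] at h00
  simp only [(hR0 _).1, (hR0 _).2, Matrix.one_apply] at h00
  simp only [ite_mul, mul_ite, one_mul, zero_mul, mul_one, mul_zero, sum_ite_eq, sum_ite_eq',
    mem_univ, if_true] at h00
  exact h00.symm

end ColumnExchange

/-! ### The case where y consists of the parameters of the last sites -/

section PackedState

variable {K : Type*} [Field K]

lemma ominus_self (β x : K) : ominus β x x = 0 := by simp [ominus]

/-- The spins with ones exactly at the sites `≥ p`. -/
def packedSpins (p : ℕ) : ℕ → Fin 2 := fun s => if p ≤ s then 1 else 0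

/-- The occupied auxiliary line must be emptied before the occupied site p + 1. An earlier drop
would make the empty line cross p with weight `u p = 0`, so the particle lands at p with weight 1 +
β·0 = 1. Above p nothing can be lifted, as the line would then meet an occupied site or leave
occupied. -/
lemma rowMatrix_packed {β : K} {u : ℕ → K} {p : ℕ} (hu : u p = 0) (b' : ℕ → Fin 2) {m : ℕ}
    (hm : p + 1 ≤ m) :
    rowMatrix β u b' (packedSpins (p + 1)) m 0 1 =
      if ∀ s < m, b' s = packedSpins p s then 1 else 0 := by
  have h1 : ∀ m ≤ p, rowMatrix β u b' (packedSpins (p + 1)) m 1 1 =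
      if ∀ s < m, b' s = packedSpins p s then 1 else 0 := by
    intro m hm
    induction m with
    | zero => simp [rowMatrix]
    | succ m ih =>
      have e : packedSpins (p + 1) m = 0 := if_neg (by omega)
      have e' : packedSpins p m = 0 := if_neg (by omega)
      rw [rowMatrix, Matrix.mul_apply, Fin.sum_univ_two, ih (by omega), e,
        if_congr Nat.forall_lt_succ_right rfl rfl, e']
      rcases Fin.exists_fin_two.1 ⟨b' m, rfl⟩ with h | h <;> simp [vertex, h]
  induction m, hm using Nat.le_induction with
  | base =>
    have e : packedSpins (p + 1) p = 0 := if_neg (by omega)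
    have e' : packedSpins p p = 1 := if_pos le_rfl
    rw [rowMatrix, Matrix.mul_apply, Fin.sum_univ_two, h1 p le_rfl, e,
      if_congr Nat.forall_lt_succ_right rfl rfl, e', hu]
    rcases Fin.exists_fin_two.1 ⟨b' p, rfl⟩ with h | h <;> simp [vertex, h]
  | succ m hm ih =>
    have e : packedSpins (p + 1) m = 1 := if_pos hm
    have e' : packedSpins p m = 1 := if_pos (by omega)
    rw [rowMatrix, Matrix.mul_apply, Fin.sum_univ_two, ih, e,
      if_congr Nat.forall_lt_succ_right rfl rfl, e']
    rcases Fin.exists_fin_two.1 ⟨b' m, rfl⟩ with h | h <;> simp [vertex, h]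

/-- The first B to act has the parameter of the last site and fills it; each further one fills the
next lower site. -/
lemma prod_opB_packed (β : K) {N : ℕ} (t : ℤ → K) {n : ℕ} (hn : n ≤ N) (b : Fin N → Fin 2) :
    (List.ofFn fun i : Fin n => opB β N t (t ((N - 1 - i : ℕ) + 1))).reverse.prod b (fun _ => 0) =
      if b = (fun j : Fin N => packedSpins (N - n) j) then 1 else 0 := by
  induction n generalizing b with
  | zero =>
    have : (fun j : Fin N => packedSpins (N - 0) j) = fun _ => 0 :=
      funext fun j => if_neg (by omega)
    rw [List.ofFn_zero, List.reverse_nil, List.prod_nil, Matrix.one_apply, this]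
  | succ n ih =>
    rw [List.ofFn_succ', List.concat_eq_append, List.reverse_append, List.reverse_singleton,
      List.singleton_append, List.prod_cons, Matrix.mul_apply]
    simp only [Fin.val_castSucc, Fin.val_last, ih (by omega), mul_ite, mul_one, mul_zero,
      sum_ite_eq', mem_univ, if_true]
    have hp : N - n = N - (n + 1) + 1 := by omega
    have hp' : N - 1 - n = N - (n + 1) := by omega
    rw [opB, monodromy_apply, hp, hp']
    have hc : (∀ s < N, extendSpins b s = packedSpins (N - (n + 1)) s) ↔
        b = fun j : Fin N => packedSpins (N - (n + 1)) j := by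
      constructor
      · intro h
        funext j
        rw [← extendSpins_apply b j, h j j.2]
      · rintro rfl s hs
        rw [extendSpins_of_lt _ hs]
    rw [← if_congr hc rfl rfl, ← rowMatrix_packed (β := β)
      (u := fun s => ominus β (t ((N - (n + 1) : ℕ) + 1)) (t (s + 1))) (ominus_self β _)
      (extendSpins b) (m := N) (by omega)]
    refine congrFun (congrFun (rowMatrix_congr (fun _ _ => rfl) (fun _ _ => rfl)
      fun s hs => ?_) 0) 1
    rw [extendSpins_of_lt _ hs]

lemma state_const (n k : ℕ) :
    state (n + k) (fun _ : Fin n => k) = fun j : Fin (n + k) => packedSpins (n + k - n) j := by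
  funext j
  rw [state, spins, packedSpins]
  refine if_congr ?_ rfl rfl
  constructor
  · rintro ⟨i, hi⟩; omega
  · intro h
    refine ⟨Fin.rev ⟨(j : ℕ) - k, by omega⟩, ?_⟩
    rw [Fin.rev_rev]
    simp only
    omega

/-- A rectangle interlaces only with the rectangle having one row less, so every branching has a
single term and no corner factor. -/
lemma groth_shape_const (β : K) {n : ℕ} (k : ℕ) (x : Fin n → K) (t : ℤ → K) :
    groth β (shape fun _ : Fin n => k) x t = ∏ i, ∏ j ∈ range k, oplus β (x i) (t (j + 1)) := by
  induction n with
  | zero =>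
    have h1 : (shape fun _ : Fin 0 => k) = ∅ := by simp [shape]
    rw [h1, groth_empty, univ_eq_empty, prod_empty]
  | succ n ih =>
    have h : interlacing (fun _ : Fin (n + 1) => k) = {fun _ => k} := by
      ext ν
      rw [mem_interlacing, mem_singleton, funext_iff]
      exact forall_congr' fun i => ⟨fun h => le_antisymm h.2 h.1, fun h => by simp [h]⟩
    rw [groth_shape_succ β antitone_const, h, sum_singleton, ih, Fin.prod_univ_castSucc, mul_comm]
    simp [rowWeight]

theorem eForm_packed {β : K} {n k : ℕ} {t : ℤ → K}
    (ht : ∀ s < n + k, 1 + β * t ((s : ℕ) + 1) ≠ 0) (x : Fin n → K) :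
    eForm β (n + k) t x (fun i => t ((n + k - 1 - i : ℕ) + 1)) =
      ∏ i, ∏ j ∈ range k, ominus β (x i) (t (j + 1)) := by
  rw [eForm, Matrix.mul_apply]
  simp_rw [prod_opB_packed β t (Nat.le_add_right n k), ← state_const]
  simp only [mul_ite, mul_one, mul_zero, sum_ite_eq', mem_univ, if_true]
  rw [prod_opC_state ht x antitone_const (fun _ => by omega), groth_shape_const]
  refine prod_congr rfl fun i _ => prod_congr rfl fun j hj => ?_
  rw [mem_range] at hj
  exact oplus_negParams (ht j (by omega)) _

end PackedState

/-! ### Symmetry of e in the parameters and the product formula -/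

section Permutation

variable {K : Type*} [Field K]

lemma monodromy_congr {β : K} {N : ℕ} {t t' : ℤ → K}
    (h : ∀ s < N, t ((s : ℕ) + 1) = t' ((s : ℕ) + 1)) (x : K) (a c : Fin 2) :
    monodromy β N t x a c = monodromy β N t' x a c := by
  funext b' b
  rw [monodromy_apply, monodromy_apply]
  exact congrFun (congrFun (rowMatrix_congr (fun s hs => by simp only [h s hs]) (fun _ _ => rfl)
    fun _ _ => rfl) a) c

lemma eForm_congr {β : K} {N : ℕ} {t t' : ℤ → K}
    (h : ∀ s < N, t ((s : ℕ) + 1) = t' ((s : ℕ) + 1)) {n : ℕ} (x y : Fin n → K) :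
    eForm β N t x y = eForm β N t' x y := by
  simp only [eForm, opB, opC, monodromy_congr h]

/-- The parameters with `t_{j+1} = τ j` for `0 ≤ j < N` and zero elsewhere. -/
def extendParams {N : ℕ} (τ : Fin N → K) : ℤ → K :=
  fun z => if h : 1 ≤ z ∧ z ≤ N then τ ⟨(z - 1).toNat, by omega⟩ else 0

lemma extendParams_apply {N : ℕ} (τ : Fin N → K) {s : ℕ} (hs : s < N) :
    extendParams τ ((s : ℤ) + 1) = τ ⟨s, hs⟩ := by
  rw [extendParams, dif_pos (by omega)]
  congr 1
  ext
  simp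

lemma extendParams_of_le {N : ℕ} (τ : Fin N → K) {s : ℕ} (hs : N ≤ s) :
    extendParams τ ((s : ℤ) + 1) = 0 := by
  rw [extendParams, dif_neg (by omega)]

/-- Adjacent transpositions generate the symmetric group. The parameters τ stay general because the
second factor of a product acts on already permuted parameters. -/
theorem eForm_perm {β : K} {N : ℕ} (σ : Equiv.Perm (Fin N)) {n : ℕ} (x y : Fin n → K)
    (τ : Fin N → K) (hτ : ∀ j, 1 + β * τ j ≠ 0) :
    eForm β N (extendParams (τ ∘ σ)) x y = eForm β N (extendParams τ) x y := by
  rcases N with _ | N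
  · rw [Subsingleton.elim (τ ∘ σ) τ]
  have hσ : σ ∈ Submonoid.closure
      (Set.range fun i : Fin N ↦ Equiv.swap i.castSucc i.succ) := by
    rw [Equiv.Perm.mclosure_swap_castSucc_succ]; trivial
  induction hσ using Submonoid.closure_induction generalizing τ with
  | one => rfl
  | mul σ σ' _ _ ih ih' =>
    have : τ ∘ (σ * σ' : Equiv.Perm _) = (τ ∘ σ) ∘ σ' := rfl
    rw [this, ih' (τ ∘ σ) fun j => hτ _, ih _ hτ]
  | mem σ h =>
    obtain ⟨i, rfl⟩ := h
    have hi := i.2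
    have e0 := fun τ : Fin (N + 1) → K => extendParams_apply τ (s := i) (by omega)
    have e1 := fun τ : Fin (N + 1) → K => extendParams_apply τ (s := i + 1) (by omega)
    have c0 : (⟨i, by omega⟩ : Fin (N + 1)) = i.castSucc := rfl
    have c1 : (⟨i + 1, by omega⟩ : Fin (N + 1)) = i.succ := rfl
    refine eForm_swap (j := i) (by omega) ?_ ?_ ?_ ?_ ?_ x y
    · rw [e0]; exact hτ _
    · rw [e1]; exact hτ _
    · rw [e0, e1, c0, c1]; simp
    · rw [e0, e1, c0, c1]; simp
    · intro s h1 h2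
      by_cases hs : s < N + 1
      · rw [extendParams_apply _ hs, extendParams_apply _ hs, Function.comp_apply,
          Equiv.swap_apply_of_ne_of_ne]
        · exact fun h => h1 (congrArg Fin.val h)
        · exact fun h => h2 (congrArg Fin.val h)
      · rw [extendParams_of_le _ (by omega), extendParams_of_le _ (by omega)]

theorem eForm_tParams {β : K} {n k : ℕ} {t : ℤ → K}
    (ht : ∀ s < n + k, 1 + β * t ((s : ℕ) + 1) ≠ 0) (mu : BoxedPartition n k) (x : Fin n → K) :
    eForm β (n + k) t x (tParams t mu) =
      ∏ i, ∏ j ∈ oneLettersStar mu, ominus β (x i) (t j) := by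
  choose g hg using letterPos_mem mu
  have hginj : Function.Injective g := fun i i' h => (strictMono_letterPos mu).injective (by
    rw [← hg, ← hg, h])
  -- The last n sites in decreasing order, as `eForm_packed` expects them.
  let f : Fin n → Fin (n + k) := fun i => ⟨n + k - 1 - i, by omega⟩
  have hfinj : Function.Injective f := fun i i' h => by
    have := congrArg Fin.val h
    simp only [f] at this
    exact Fin.ext (by omega)
  -- The symmetric group is n-transitive, so some σ carries these sites to the positions of the
  -- 1-letters of μ.
  obtain ⟨σ, hσ⟩ := (Equiv.Perm.isMultiplyPretransitive (Fin (n + k)) n).exists_smul_eq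
    (⟨f, hfinj⟩ : Fin n ↪ Fin (n + k)) ⟨g, hginj⟩
  have hσ' : ∀ i, σ (f i) = g i := fun i => DFunLike.congr_fun hσ i
  let τ : Fin (n + k) → K := fun j => t ((j : ℕ) + 1)
  have hτ : ∀ j, 1 + β * τ j ≠ 0 := fun j => ht j j.2
  have hτσ : ∀ s < n + k, 1 + β * extendParams (τ ∘ σ) ((s : ℕ) + 1) ≠ 0 := fun s hs => by
    rw [extendParams_apply _ hs]; exact hτ _
  rw [eForm_congr (t' := extendParams τ) fun s hs => by rw [extendParams_apply _ hs],
    ← eForm_perm σ x _ τ hτ]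
  have hy : tParams t mu = fun i : Fin n =>
      extendParams (τ ∘ σ) ((n + k - 1 - i : ℕ) + 1) := by
    funext i
    rw [extendParams_apply _ (show n + k - 1 - (i : ℕ) < n + k by omega), tParams, ← hg i, ← hσ' i]
    rfl
  rw [hy, eForm_packed hτσ]
  refine prod_congr rfl fun i _ => ?_
  -- Since σ maps the last n sites onto I_μ, it maps the first k sites onto the complement.
  refine prod_bij (fun j hj => ((σ ⟨j, by rw [mem_range] at hj; omega⟩ : ℕ) : ℤ) + 1) ?_ ?_ ?_ ?_
  · intro j hj
    rw [mem_range] at hj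
    rw [oneLettersStar, mem_sdiff, mem_Icc, oneLetters, mem_image]
    refine ⟨by omega, ?_⟩
    rintro ⟨i, _, hi⟩
    rw [← hg i, ← hσ' i] at hi
    have h1 : σ (f i) = σ ⟨j, by omega⟩ := Fin.ext (by omega)
    have h2 := congrArg Fin.val (σ.injective h1)
    simp only [f] at h2
    omega
  · intro j hj j' hj' h
    have h1 : σ ⟨j, by rw [mem_range] at hj; omega⟩ = σ ⟨j', by rw [mem_range] at hj'; omega⟩ :=
      Fin.ext (by omega)
    exact congrArg Fin.val (σ.injective h1)
  · intro z hz
    rw [oneLettersStar, mem_sdiff, mem_Icc, oneLetters, mem_image] at hz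
    obtain ⟨⟨h1, h2⟩, h3⟩ := hz
    obtain ⟨j, hj⟩ := σ.surjective ⟨(z - 1).toNat, by omega⟩
    have hz : ((σ j : ℕ) : ℤ) + 1 = z := by rw [hj]; simp only; omega
    refine ⟨j, ?_, hz⟩
    rw [mem_range]
    by_contra hjk
    -- A site j ≥ k is the value of f at n + k − 1 − j, so its image would lie in I_μ.
    refine h3 ⟨⟨n + k - 1 - j, by omega⟩, mem_univ _, ?_⟩
    have hf : f ⟨n + k - 1 - j, by omega⟩ = j := Fin.ext (by simp only [f]; omega)
    rw [← hg, ← hσ', hf, hz]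
  · intro j hj
    rw [mem_range] at hj
    rw [extendParams_apply _ (show j < n + k by omega)]
    rfl

end Permutation

end FactorialGrothendieck

/-! ### Comparison of the two evaluations -/

theorem mainTheorem8 {K : Type*} [Field K] (β : K) (n k : ℕ) (t : ℤ → K)
    (ht : ∀ j ∈ Finset.Icc (1 : ℤ) ((n + k : ℕ) : ℤ), 1 + β * t j ≠ 0)
    (mu : BoxedPartition n k) :
    (∀ x : Fin n → K,
      ∏ i, ∏ j ∈ oneLettersStar mu, ominus β (x i) (t j) =
        ∑ lam : BoxedPartition n k,
          bigPi β (tParams t mu) / bigPi β (tParams t lam) *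
            groth β (diagram (vee lam)) (tParams t mu) (negParams β (revParams (n + k) t)) *
            groth β (diagram lam) x (negParams β t)) ∧
    eForm β (n + k) t (tParams t mu) (tParams t mu) =
      ∏ i ∈ oneLetters mu, ∏ j ∈ oneLettersStar mu, ominus β (t i) (t j) := by
  have ht' : ∀ s < n + k, 1 + β * t ((s : ℕ) + 1) ≠ 0 := fun s hs =>
    ht _ (Finset.mem_Icc.2 (by omega))
  constructor
  · intro x
    rw [← eForm_tParams ht', eForm_eq_sum_groth ht']
  · rw [eForm_tParams ht', oneLetters,
      Finset.prod_image (strictMono_letterPos mu).injective.injOn]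
    rfl
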